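/- For $\alpha\in\mathbb D=\{z\in\mathbb C:|z|<1\}$ and $\lambda\in\partial\mathbb D$ let $$\Theta(\alpha,\lambda)=\lambda\begin{pmatrix}\overline\alpha&\rho\\ \rho&-\alpha\end{pmatrix},\qquad \rho=\sqrt{1-|\alpha|^2}.$$ For a sequence $(\alpha_n,\lambda_n)_{n\in\mathbb Z}$ in $\mathbb D\times\partial\mathbb D$ define on $\ell^2(\mathbb Z)$ the unitary operators $\mathcal L=\bigoplus_{j}\Theta(\alpha_{2j},\lambda_{2j})$ and $\mathcal M=\bigoplus_{j}\Theta(\alpha_{2j+1},\lambda_{2j+1})$, where $\Theta(\alpha_k,\lambda_k)$ acts on $\ell^2(\{k,k+1\})$. The pCMV (phased CMV) operator with these coefficients is $\mathcal E_{\alpha,\lambda}=\mathcal L\mathcal M$. It is called periodic if for some integer $q\ge 1$ one has $\alpha_{n+q}=\alpha_n$ and $\lambda_{n+q}=\lambda_n$ for all $n$, and limit-periodic if it is a limit, in operator norm, of periodic pCMV operators. For $0<r<1$ let $\mathrm{LP}(r)$ be the set of limit-periodic pCMV operators with $\|\alpha\|_\infty\le r$, and let $\mathrm{LP}=\bigcup_{0<r<1}\mathrm{LP}(r)$,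 with the metric $d(\mathcal E,\mathcal E')=\|\mathcal E-\mathcal E'\|$. Theorem. For every $\delta>0$, the set $$M_\delta=\{\mathcal E\in\mathrm{LP}:\ \mathrm{Leb}(\sigma(\mathcal E))<\delta\}$$ is a dense and open subset of $\mathrm{LP}$, where $\sigma(\mathcal E)\subseteq\partial\mathbb D$ is the spectrum and $\mathrm{Leb}$ is Lebesgue (arc length) measure on the unit circle. -/

import Mathlib

open scoped Complex.UnitDisc lp ENNReal ComplexConjugate

noncomputable section

namespace PCMV

/-- The `2 × 2` unitary matrix `Θ(α, lam)`, for `α` in the open unit disc and `lam` on the unit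
circle. -/
def Theta (α : 𝔻) (lam : Circle) : Matrix (Fin 2) (Fin 2) ℂ :=
  (lam : ℂ) • !![conj (α : ℂ), (Real.sqrt (1 - ‖(α : ℂ)‖ ^ 2) : ℂ);
                 (Real.sqrt (1 - ‖(α : ℂ)‖ ^ 2) : ℂ), -(α : ℂ)]

theorem norm_Theta_le (α : 𝔻) (lam : Circle) (i j : Fin 2) : ‖Theta α lam i j‖ ≤ 1 := by
  have h1 : ‖(α : ℂ)‖ ≤ 1 := α.norm_lt_one.le
  have h2 : |Real.sqrt (1 - ‖(α : ℂ)‖ ^ 2)| ≤ 1 := by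
    rw [abs_of_nonneg (Real.sqrt_nonneg _)]
    exact Real.sqrt_le_one.mpr (by nlinarith [sq_nonneg ‖(α : ℂ)‖])
  have h3 : ‖(lam : ℂ)‖ = 1 := Circle.norm_coe lam
  fin_cases i <;> fin_cases j <;> simpa [Theta, h3] using by assumption

/-- The action on sequences of the block diagonal matrix `⨁ A k`, the sum being over all integers
`k` with `k - p` even, where the `2 × 2` matrix `A k` acts on the coordinates `k, k + 1`. -/
def blockFun (p : ℤ) (A : ℤ → Matrix (Fin 2) (Fin 2) ℂ) (x : ℤ → ℂ) (k : ℤ) : ℂ :=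
  if Even (k - p) then A k 0 0 * x k + A k 0 1 * x (k + 1)
  else A (k - 1) 1 0 * x (k - 1) + A (k - 1) 1 1 * x k

theorem norm_blockFun_sq_le (p : ℤ) (A : ℤ → Matrix (Fin 2) (Fin 2) ℂ)
    (hA : ∀ k i j, ‖A k i j‖ ≤ 1) (x : ℤ → ℂ) (k : ℤ) :
    ‖blockFun p A x k‖ ^ 2 ≤ 3 * (‖x k‖ ^ 2 + ‖x (k + 1)‖ ^ 2 + ‖x (k - 1)‖ ^ 2) := by
  have key : ∀ (a b u v : ℂ), ‖a‖ ≤ 1 → ‖b‖ ≤ 1 → ‖a * u + b * v‖ ≤ ‖u‖ + ‖v‖ := by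
    intro a b u v ha hb
    refine (norm_add_le _ _).trans ?_
    rw [norm_mul, norm_mul]
    exact add_le_add (mul_le_of_le_one_left (norm_nonneg _) ha)
      (mul_le_of_le_one_left (norm_nonneg _) hb)
  have h : ‖blockFun p A x k‖ ≤ ‖x k‖ + ‖x (k + 1)‖ + ‖x (k - 1)‖ := by
    unfold blockFun
    split_ifs
    · have := key _ _ (x k) (x (k + 1)) (hA k 0 0) (hA k 0 1)
      linarith [norm_nonneg (x (k - 1))]
    · have := key _ _ (x (k - 1)) (x k) (hA (k - 1) 1 0) (hA (k - 1) 1 1)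
      linarith [norm_nonneg (x (k + 1))]
  have h0 := norm_nonneg (blockFun p A x k)
  nlinarith [sq_nonneg (‖x k‖ - ‖x (k + 1)‖), sq_nonneg (‖x k‖ - ‖x (k - 1)‖),
    sq_nonneg (‖x (k + 1)‖ - ‖x (k - 1)‖)]

theorem hasSum_sq (x : ℓ²(ℤ, ℂ)) : HasSum (fun k => ‖x k‖ ^ 2) (‖x‖ ^ 2) := by
  simpa using lp.hasSum_norm (p := 2) (by norm_num) x

theorem hasSum_bound (x : ℓ²(ℤ, ℂ)) :
    HasSum (fun k => 3 * (‖x k‖ ^ 2 + ‖x (k + 1)‖ ^ 2 + ‖x (k - 1)‖ ^ 2)) ((3 * ‖x‖) ^ 2) := by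
  have h := hasSum_sq x
  have h1 := (Equiv.addRight (1 : ℤ)).hasSum_iff.mpr h
  have h2 := (Equiv.subRight (1 : ℤ)).hasSum_iff.mpr h
  have := ((h.add h1).add h2).mul_left 3
  have e : (3 * ‖x‖) ^ 2 = 3 * (‖x‖ ^ 2 + ‖x‖ ^ 2 + ‖x‖ ^ 2) := by ring
  rw [e]
  exact this

theorem memlp_blockFun (p : ℤ) (A : ℤ → Matrix (Fin 2) (Fin 2) ℂ)
    (hA : ∀ k i j, ‖A k i j‖ ≤ 1) (x : ℓ²(ℤ, ℂ)) : Memℓp (blockFun p A x) 2 := by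
  refine memℓp_gen ?_
  have := Summable.of_nonneg_of_le (fun k => sq_nonneg _)
    (norm_blockFun_sq_le p A hA x) (hasSum_bound x).summable
  simpa using this

/-- The bounded operator on `ℓ²(ℤ)` given by the block diagonal matrix `⨁ A k`, the sum being over
all integers `k` with `k - p` even, where `A k` acts on `ℓ²({k, k + 1})`. -/
def blockOp (p : ℤ) (A : ℤ → Matrix (Fin 2) (Fin 2) ℂ) (hA : ∀ k i j, ‖A k i j‖ ≤ 1) :
    ℓ²(ℤ, ℂ) →L[ℂ] ℓ²(ℤ, ℂ) :=
  LinearMap.mkContinuous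
    { toFun := fun x => ⟨blockFun p A x, memlp_blockFun p A hA x⟩
      map_add' := by
        intro x y
        ext k
        simp only [blockFun, lp.coeFn_add, Pi.add_apply]
        split_ifs <;> ring
      map_smul' := by
        intro c x
        ext k
        simp only [blockFun, lp.coeFn_smul, Pi.smul_apply, smul_eq_mul, RingHom.id_apply]
        split_ifs <;> ring }
    3 (by
      intro x
      have h1 := hasSum_sq ⟨blockFun p A x, memlp_blockFun p A hA x⟩
      exact le_of_sq_le_sq
        (hasSum_le (norm_blockFun_sq_le p A hA x) h1 (hasSum_bound x)) (by positivity))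

/-- `ℒ = ⨁ Θ(α (2j), lam (2j))`. -/
def opL (α : ℤ → 𝔻) (lam : ℤ → Circle) : ℓ²(ℤ, ℂ) →L[ℂ] ℓ²(ℤ, ℂ) :=
  blockOp 0 (fun k => Theta (α k) (lam k)) (fun k => norm_Theta_le (α k) (lam k))

/-- `ℳ = ⨁ Θ(α (2j+1), lam (2j+1))`. -/
def opM (α : ℤ → 𝔻) (lam : ℤ → Circle) : ℓ²(ℤ, ℂ) →L[ℂ] ℓ²(ℤ, ℂ) :=
  blockOp 1 (fun k => Theta (α k) (lam k)) (fun k => norm_Theta_le (α k) (lam k))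

/-- The phased CMV operator `ℰ = ℒ ℳ` with Verblunsky coefficients `α` and phases `lam`. -/
def pcmv (α : ℤ → 𝔻) (lam : ℤ → Circle) : ℓ²(ℤ, ℂ) →L[ℂ] ℓ²(ℤ, ℂ) :=
  opL α lam ∘L opM α lam

/-- `E` is a periodic pCMV operator: its coefficients and phases have a common period `q ≥ 1`. -/
def IsPeriodic (E : ℓ²(ℤ, ℂ) →L[ℂ] ℓ²(ℤ, ℂ)) : Prop :=
  ∃ (α : ℤ → 𝔻) (lam : ℤ → Circle), E = pcmv α lam ∧
    ∃ q : ℕ, 0 < q ∧ ∀ n : ℤ, α (n + q) = α n ∧ lam (n + q) = lam n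

/-- `LP(r)`: the pCMV operators `E` with `‖α‖∞ ≤ r` that are limit-periodic, i.e. limits in
operator norm of periodic pCMV operators. -/
def LPr (r : ℝ) : Set (ℓ²(ℤ, ℂ) →L[ℂ] ℓ²(ℤ, ℂ)) :=
  {E | (∃ (α : ℤ → 𝔻) (lam : ℤ → Circle), E = pcmv α lam ∧ ∀ n, ‖(α n : ℂ)‖ ≤ r) ∧
    ∃ F : ℕ → (ℓ²(ℤ, ℂ) →L[ℂ] ℓ²(ℤ, ℂ)),
      (∀ n, IsPeriodic (F n)) ∧ Filter.Tendsto F Filter.atTop (nhds E)}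

/-- `LP`, the union of the `LP(r)` over `0 < r < 1`. As a type it carries the metric
`‖E - E'‖`. -/
def LP : Set (ℓ²(ℤ, ℂ) →L[ℂ] ℓ²(ℤ, ℂ)) :=
  ⋃ r ∈ Set.Ioo (0 : ℝ) 1, LPr r

/-- Lebesgue (arc length) measure of the part of `S` on the unit circle. -/
def circleLeb (S : Set ℂ) : ℝ≥0∞ :=
  MeasureTheory.volume {θ : ℝ | θ ∈ Set.Ioc (-Real.pi) Real.pi ∧
    Complex.exp (θ * Complex.I) ∈ S}

/-- The set of operators in `LP` whose spectrum has Lebesgue measure less than `δ`. -/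
def thinSpectrum (δ : ℝ) : Set LP :=
  {E | circleLeb (spectrum ℂ (E : ℓ²(ℤ, ℂ) →L[ℂ] ℓ²(ℤ, ℂ))) < ENNReal.ofReal δ}

end PCMV

end

namespace PCMV

/-! ### Block operators -/

/-! Openness is upper semicontinuity of the spectrum. A spectrum of small arc length lies in an open
set of small arc length (outer regularity), and operators close in norm have the unit-circle part of
their spectrum in the same open set (`isOpen_setOf_spectrum_subset`, a tube lemma on a compact part
of the circle).

For density it suffices to perturb a periodic operator. The first step opens a gap at any prescribed
`z` on the circle (`exists_periodic_gap`). The monodromy matrix `A` at `z` lies in SU(1,1). If it is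
not already hyperbolic, the phases allow the transfer matrix at one site per period to be multiplied
by an arbitrary element of SU(1,1) near the identity. Over many periods, words in matrices `A * g`
near `A` become available: one choice makes `A * g` elliptic, its powers return near the identity,
and a single extra boost makes the trace exceed 2. A trace of modulus above 2 bounds `ℰ - z` below,
because over two periods Cayley-Hamilton gives a three-term recurrence whose middle coefficient
dominates (`exists_bounded_below_of_trace`).

By compactness of the circle, finitely many nearby periodic operators have gaps, of common size `g`,
that cover every `z` (`exists_finite_gap_cover`). These are concatenated cyclically in long blocks.
If `z` is in the gap of the `j`-th operator, approximate eigenvectors at `z` decay exponentially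
inside the blocks of type `j` (`restr_decay`), so cutting the operator in the middle of those blocks
is a small perturbation for them. The cut operator is a periodic direct sum of copies of one finite
matrix, so it has finitely many spectral points (`exists_spectrum_cutOp_subset`). The whole spectrum
is therefore exponentially close to a finite set whose cardinality is only linear in the block
length, and its arc length tends to zero as the blocks grow. -/

theorem blockOp_apply (p : ℤ) (A : ℤ → Matrix (Fin 2) (Fin 2) ℂ) (hA : ∀ k i j, ‖A k i j‖ ≤ 1)
    (x : ℓ²(ℤ, ℂ)) (k : ℤ) : blockOp p A hA x k = blockFun p A x k := rfl

theorem norm_blockOp_le (p : ℤ) (A : ℤ → Matrix (Fin 2) (Fin 2) ℂ) (hA : ∀ k i j, ‖A k i j‖ ≤ 1) :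
    ‖blockOp p A hA‖ ≤ 3 :=
  LinearMap.mkContinuous_norm_le _ (by norm_num) _

theorem norm_blockOp_sub_le (p : ℤ) (A B : ℤ → Matrix (Fin 2) (Fin 2) ℂ)
    (hA : ∀ k i j, ‖A k i j‖ ≤ 1) (hB : ∀ k i j, ‖B k i j‖ ≤ 1) {c : ℝ} (hc : 0 < c)
    (h : ∀ k i j, ‖A k i j - B k i j‖ ≤ c) : ‖blockOp p A hA - blockOp p B hB‖ ≤ 3 * c := by
  -- Rescaling by `c⁻¹` puts the difference of the blocks back under the entry bound 1, so the crude
  -- norm bound 3 applies to it.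
  have hD : ∀ k i j, ‖((c : ℂ)⁻¹ • (A k - B k)) i j‖ ≤ 1 := by
    intro k i j
    rw [Matrix.smul_apply, norm_smul, norm_inv, Complex.norm_real, Real.norm_of_nonneg hc.le,
      inv_mul_le_one₀ hc]
    exact h k i j
  have e : blockOp p A hA - blockOp p B hB
      = (c : ℂ) • blockOp p (fun k => (c : ℂ)⁻¹ • (A k - B k)) hD := by
    have hc' : (c : ℂ) ≠ 0 := by exact_mod_cast hc.ne'
    ext x k
    simp only [sub_apply, smul_apply, lp.coeFn_sub,
      lp.coeFn_smul, Pi.sub_apply, Pi.smul_apply, blockOp_apply, blockFun, Matrix.smul_apply,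
      Matrix.sub_apply, smul_eq_mul]
    split_ifs <;> field_simp <;> ring
  rw [e, norm_smul, Complex.norm_real, Real.norm_of_nonneg hc.le, mul_comm]
  exact mul_le_mul_of_nonneg_right (norm_blockOp_le _ _ _) hc.le

theorem blockOp_comp_eq_one (p : ℤ) (A B : ℤ → Matrix (Fin 2) (Fin 2) ℂ)
    (hA : ∀ k i j, ‖A k i j‖ ≤ 1) (hB : ∀ k i j, ‖B k i j‖ ≤ 1) (h : ∀ k, A k * B k = 1) :
    blockOp p A hA * blockOp p B hB = 1 := by
  have h' : ∀ k i j, A k i 0 * B k 0 j + A k i 1 * B k 1 j = (1 : Matrix (Fin 2) (Fin 2) ℂ) i j := by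
    intro k i j
    rw [← h k, Matrix.mul_apply, Fin.sum_univ_two]
  ext x k
  rw [mul_apply_eq_comp, blockOp_apply]
  by_cases hk : Even (k - p)
  · have hk1 : ¬ Even (k + 1 - p) := by grind
    have h0 := h' k 0 0
    have h1 := h' k 0 1
    simp only [Matrix.one_apply] at h0 h1
    simp only [blockFun, if_pos hk, blockOp_apply, if_neg hk1, add_sub_cancel_right]
    simp only [one_apply_eq_self]
    simp at h0 h1
    linear_combination x k * h0 + x (k + 1) * h1
  · have hk1 : Even (k - 1 - p) := by grind
    have h0 := h' (k - 1) 1 0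
    have h1 := h' (k - 1) 1 1
    simp only [blockFun, if_neg hk, blockOp_apply, if_pos hk1, sub_add_cancel]
    simp only [one_apply_eq_self]
    simp at h0 h1
    linear_combination x (k - 1) * h0 + x k * h1

theorem norm_sq_add_norm_sq_of_unitary {A : Matrix (Fin 2) (Fin 2) ℂ} (hA : star A * A = 1) (x y : ℂ) :
    ‖A 0 0 * x + A 0 1 * y‖ ^ 2 + ‖A 1 0 * x + A 1 1 * y‖ ^ 2 = ‖x‖ ^ 2 + ‖y‖ ^ 2 := by
  have h' : ∀ i j, conj (A 0 i) * A 0 j + conj (A 1 i) * A 1 j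
      = (1 : Matrix (Fin 2) (Fin 2) ℂ) i j := by
    intro i j
    rw [← hA, Matrix.mul_apply, Fin.sum_univ_two]
    rfl
  have h00 := h' 0 0
  have h01 := h' 0 1
  have h10 := h' 1 0
  have h11 := h' 1 1
  simp at h00 h01 h10 h11
  have : ((‖A 0 0 * x + A 0 1 * y‖ ^ 2 + ‖A 1 0 * x + A 1 1 * y‖ ^ 2 : ℝ) : ℂ)
      = ((‖x‖ ^ 2 + ‖y‖ ^ 2 : ℝ) : ℂ) := by
    push_cast
    simp only [← Complex.conj_mul', map_add, map_mul]
    linear_combination conj x * x * h00 + conj x * y * h01 + conj y * x * h10 + conj y * y * h11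
  exact_mod_cast this

/-- The sum telescopes: with `g` the part of `f` on one parity class, `f k = g k - g (k - 1)`, and
both terms have the same sum. This turns isometry of each block into isometry of the block operator.
-/
theorem hasSum_eq_zero_of_alternating (p : ℤ) {f : ℤ → ℝ} {s : ℝ} (hs : HasSum f s)
    (hpair : ∀ k, Even (k - p) → f k + f (k + 1) = 0) : s = 0 := by
  set g : ℤ → ℝ := Set.indicator {k | Even (k - p)} f with hg
  have hgs : Summable g := hs.summable.indicator _
  have hfg : f = fun k => g k - g (k - 1) := by
    ext k
    by_cases hk : Even (k - p)
    · have hk1 : ¬ Even (k - 1 - p) := by grind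
      rw [hg, Set.indicator_of_mem (s := {k | Even (k - p)}) hk, Set.indicator_of_notMem (s := {k | Even (k - p)}) hk1,
        sub_zero]
    · have hk1 : Even (k - 1 - p) := by grind
      have := hpair _ hk1
      rw [sub_add_cancel] at this
      rw [hg, Set.indicator_of_notMem (s := {k | Even (k - p)}) hk,
        Set.indicator_of_mem (s := {k | Even (k - p)}) hk1]
      linarith
  obtain ⟨t, ht⟩ := hgs
  have h1 : HasSum (g ∘ Equiv.subRight (1 : ℤ)) t := (Equiv.hasSum_iff _).mpr ht
  have h2 := ht.sub h1
  rw [sub_self] at h2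
  refine hs.unique ?_
  rw [hfg]
  exact h2

theorem norm_blockOp_apply (p : ℤ) (A : ℤ → Matrix (Fin 2) (Fin 2) ℂ) (hA : ∀ k i j, ‖A k i j‖ ≤ 1)
    (h : ∀ k, star (A k) * A k = 1) (x : ℓ²(ℤ, ℂ)) : ‖blockOp p A hA x‖ = ‖x‖ := by
  have hs := (hasSum_sq (blockOp p A hA x)).sub (hasSum_sq x)
  have h3 := hasSum_eq_zero_of_alternating p hs fun k hk => by
    have hk1 : ¬ Even (k + 1 - p) := by grind
    have := norm_sq_add_norm_sq_of_unitary (h k) (x k) (x (k + 1))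
    simp only [blockOp_apply, blockFun, if_pos hk, if_neg hk1, add_sub_cancel_right]
    linarith
  exact (sq_eq_sq₀ (norm_nonneg _) (norm_nonneg _)).mp (sub_eq_zero.mp h3)

/-- Isometry makes the adjoint a left inverse, and the block operator of the adjoint blocks is a
right inverse, so the two coincide. The adjoint of a block operator never has to be computed. -/
theorem blockOp_mem_unitary (p : ℤ) (A : ℤ → Matrix (Fin 2) (Fin 2) ℂ)
    (hA : ∀ k i j, ‖A k i j‖ ≤ 1) (h : ∀ k, A k ∈ unitary (Matrix (Fin 2) (Fin 2) ℂ)) :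
    blockOp p A hA ∈ unitary (ℓ²(ℤ, ℂ) →L[ℂ] ℓ²(ℤ, ℂ)) := by
  set U := blockOp p A hA
  have h1 : star U * U = 1 := (ContinuousLinearMap.norm_map_iff_adjoint_comp_self U).mp
    (norm_blockOp_apply p A hA fun k => (Unitary.mem_iff.mp (h k)).1)
  have hB : ∀ k i j, ‖(star (A k)) i j‖ ≤ 1 := by
    intro k i j
    rw [Matrix.star_apply, norm_star]
    exact hA k j i
  have h2 : U * blockOp p (fun k => star (A k)) hB = 1 :=
    blockOp_comp_eq_one _ _ _ _ _ fun k => (Unitary.mem_iff.mp (h k)).2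
  refine Unitary.mem_iff.mpr ⟨h1, ?_⟩
  rwa [left_inv_eq_right_inv h1 h2]

theorem normSq_add_sqrt_sq (α : 𝔻) :
    (conj (α : ℂ)) * α + (Real.sqrt (1 - ‖(α : ℂ)‖ ^ 2) : ℂ) ^ 2 = 1 := by
  have h1 : ‖(α : ℂ)‖ < 1 := α.norm_lt_one
  rw [Complex.conj_mul', ← Complex.ofReal_pow √_, Real.sq_sqrt]
  · push_cast; ring
  · nlinarith [norm_nonneg (α : ℂ)]

theorem circle_conj_mul (lam : Circle) : conj (lam : ℂ) * lam = 1 := by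
  rw [Complex.conj_mul', Circle.norm_coe]; simp

theorem Theta_mem_unitary (α : 𝔻) (lam : Circle) :
    Theta α lam ∈ unitary (Matrix (Fin 2) (Fin 2) ℂ) := by
  have h := normSq_add_sqrt_sq α
  have hl := circle_conj_mul lam
  rw [Unitary.mem_iff]
  constructor <;> ext i j <;> fin_cases i <;> fin_cases j <;>
    simp [Theta, Matrix.mul_apply, Fin.sum_univ_two, Matrix.star_apply] <;>
    generalize Real.sqrt (1 - ‖(α : ℂ)‖ ^ 2) = r at * <;>
    first
    | linear_combination hl + conj (lam : ℂ) * lam * h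
    | ring

theorem pcmv_mem_unitary (α : ℤ → 𝔻) (lam : ℤ → Circle) :
    pcmv α lam ∈ unitary (ℓ²(ℤ, ℂ) →L[ℂ] ℓ²(ℤ, ℂ)) :=
  mul_mem (blockOp_mem_unitary _ _ _ fun _ => Theta_mem_unitary _ _)
    (blockOp_mem_unitary _ _ _ fun _ => Theta_mem_unitary _ _)

theorem norm_pcmv_sub_le (α β : ℤ → 𝔻) (lam mu : ℤ → Circle) {c : ℝ} (hc : 0 < c)
    (h : ∀ k i j, ‖Theta (α k) (lam k) i j - Theta (β k) (mu k) i j‖ ≤ c) :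
    ‖pcmv α lam - pcmv β mu‖ ≤ 18 * c := by
  have e : pcmv α lam - pcmv β mu
      = opL α lam * (opM α lam - opM β mu) + (opL α lam - opL β mu) * opM β mu := by
    change opL α lam * opM α lam - opL β mu * opM β mu = _
    noncomm_ring
  have h1 : ‖opL α lam‖ ≤ 3 := norm_blockOp_le _ _ _
  have h2 : ‖opM β mu‖ ≤ 3 := norm_blockOp_le _ _ _
  have h3 : ‖opL α lam - opL β mu‖ ≤ 3 * c := norm_blockOp_sub_le _ _ _ _ _ hc h
  have h4 : ‖opM α lam - opM β mu‖ ≤ 3 * c := norm_blockOp_sub_le _ _ _ _ _ hc h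
  rw [e]
  refine (norm_add_le _ _).trans ?_
  have h5 := (norm_mul_le (opL α lam) (opM α lam - opM β mu)).trans
    (mul_le_mul h1 h4 (norm_nonneg _) (by norm_num))
  have h6 := (norm_mul_le (opL α lam - opL β mu) (opM β mu)).trans
    (mul_le_mul h3 h2 (norm_nonneg _) (by positivity))
  linarith

theorem norm_apply_of_mem_unitary {U : ℓ²(ℤ, ℂ) →L[ℂ] ℓ²(ℤ, ℂ)} (hU : U ∈ unitary _)
    (x : ℓ²(ℤ, ℂ)) : ‖U x‖ = ‖x‖ :=
  (ContinuousLinearMap.norm_map_iff_adjoint_comp_self U).mpr (Unitary.mem_iff.mp hU).1 x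

/-! ### Spectra of unitary operators -/

section Spectrum

variable {H : Type*} [NormedAddCommGroup H] [InnerProductSpace ℂ H] [CompleteSpace H]

/-- The lower bound gives injectivity and closed range. The range is also dense: a vector orthogonal
to it satisfies `star U y = conj z • y`, hence `U y = z • y`, and the lower bound forces `y = 0`. -/
theorem notMem_spectrum_of_bounded_below {U : H →L[ℂ] H} (hU : U ∈ unitary (H →L[ℂ] H)) {z : ℂ}
    (hz : ‖z‖ = 1) {c : ℝ} (hc : 0 < c) (h : ∀ x, c * ‖x‖ ≤ ‖U x - z • x‖) :
    z ∉ spectrum ℂ U := by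
  set T : H →L[ℂ] H := U - z • 1 with hT
  have hTx : ∀ x, T x = U x - z • x := fun x => by simp [hT]
  have hzz : z * conj z = 1 := by rw [Complex.mul_conj', hz]; simp
  have hanti : AntilipschitzWith (c.toNNReal)⁻¹ T := by
    refine ContinuousLinearMap.antilipschitz_of_bound _ fun x => ?_
    rw [hTx, NNReal.coe_inv, Real.coe_toNNReal c hc.le, ← div_eq_inv_mul, le_div_iff₀ hc, mul_comm]
    exact h x
  have hclosed : IsClosed (LinearMap.range T.toLinearMap : Set H) :=
    by
    rw [← T.closed_range_of_antilipschitz hanti]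
    exact Submodule.isClosed_topologicalClosure _
  have horth : (LinearMap.range T.toLinearMap)ᗮ = ⊥ := by
    rw [Submodule.eq_bot_iff]
    intro y hy
    have h1 : ContinuousLinearMap.adjoint T y = 0 := by
      rw [← inner_self_eq_zero (𝕜 := ℂ), ContinuousLinearMap.adjoint_inner_right]
      exact (Submodule.mem_orthogonal _ _).mp hy _ ⟨_, rfl⟩
    have h2 : (star U) y = conj z • y := by
      have : ContinuousLinearMap.adjoint T = star U - conj z • 1 := by
        rw [hT, ← ContinuousLinearMap.star_eq_adjoint, star_sub, star_smul, star_one]; rfl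
      rw [this] at h1
      simpa [sub_eq_zero] using h1
    have h3 : U ((star U) y) = y := by
      rw [← mul_apply_eq_comp, (Unitary.mem_iff.mp hU).2, one_apply_eq_self]
    rw [h2, map_smul] at h3
    have h4 : U y = z • y := by
      conv_rhs => rw [← h3]
      rw [smul_smul, hzz, one_smul]
    have h5 := h y
    rw [h4, sub_self, norm_zero] at h5
    exact norm_eq_zero.mp (le_antisymm (by nlinarith [norm_nonneg y]) (norm_nonneg y))
  have hsurj : Function.Surjective T := by
    have : CompleteSpace (LinearMap.range T.toLinearMap) := hclosed.completeSpace_coe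
    have := (Submodule.orthogonal_eq_bot_iff (K := LinearMap.range T.toLinearMap)).mp horth
    exact LinearMap.range_eq_top.mp this
  have hunit : IsUnit T := ContinuousLinearMap.isUnit_iff_bijective.mpr ⟨hanti.injective, hsurj⟩
  rw [spectrum.notMem_iff]
  convert hunit.neg using 1
  rw [hT, Algebra.algebraMap_eq_smul_one, neg_sub]

/-- The resolvent is normal, so its norm is its spectral radius, which is at most the inverse of the
distance from `z` to the spectrum. -/
theorem norm_sub_smul_ge_of_mem_unitary {U : H →L[ℂ] H} (hU : U ∈ unitary (H →L[ℂ] H)) {z : ℂ}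
    {κ : ℝ} (hκ : 0 < κ) (h : ∀ s ∈ spectrum ℂ U, κ ≤ ‖z - s‖) (x : H) :
    κ * ‖x‖ ≤ ‖U x - z • x‖ := by
  have hz : z ∉ spectrum ℂ U := fun hz => by
    have := h z hz
    rw [sub_self, norm_zero] at this
    linarith
  obtain ⟨u, hu⟩ : IsUnit (algebraMap ℂ (H →L[ℂ] H) z - U) := by
    rwa [spectrum.notMem_iff] at hz
  have hUn : IsStarNormal U := ⟨by
    rw [Commute, SemiconjBy, (Unitary.mem_iff.mp hU).1, (Unitary.mem_iff.mp hU).2]⟩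
  have hun : IsStarNormal (u : H →L[ℂ] H) := by
    rw [hu]
    constructor
    rw [star_sub, Algebra.algebraMap_eq_smul_one, star_smul, star_one]
    have := hUn.star_comm_self
    simp only [Commute, SemiconjBy] at this ⊢
    simp only [mul_sub, sub_mul, smul_mul_assoc, mul_smul_comm, one_mul, mul_one, this]
    simp only [smul_sub]
    rw [smul_comm z (star z)]
    abel
  have hui : IsStarNormal ((u⁻¹ : (H →L[ℂ] H)ˣ) : H →L[ℂ] H) := by
    have h1 : star u * u = u * star u := Units.ext hun.star_comm_self
    have h2 : star u⁻¹ * u⁻¹ = u⁻¹ * star u⁻¹ := by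
      rw [star_inv, ← mul_inv_rev, ← mul_inv_rev, h1]
    exact ⟨congrArg Units.val h2⟩
  have hr := IsStarNormal.spectralRadius_eq_nnnorm ((u⁻¹ : (H →L[ℂ] H)ˣ) : H →L[ℂ] H)
  have hle : spectralRadius ℂ ((u⁻¹ : (H →L[ℂ] H)ˣ) : H →L[ℂ] H) ≤ ENNReal.ofReal κ⁻¹ := by
    refine iSup₂_le fun k hk => ?_
    rw [← spectrum.map_inv, Set.mem_inv, hu, ← spectrum.singleton_sub_eq] at hk
    obtain ⟨s, hs, hsk⟩ : ∃ s ∈ spectrum ℂ U, z - s = k⁻¹ := by simpa using hk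
    have h1 := h s hs
    rw [hsk, norm_inv] at h1
    have hk0 : 0 < ‖k‖ := by
      rcases (norm_nonneg k).eq_or_lt with h0 | h0
      · rw [← h0, inv_zero] at h1; linarith
      · exact h0
    rw [← ENNReal.ofReal_coe_nnreal, coe_nnnorm, ENNReal.ofReal_le_ofReal_iff (by positivity)]
    exact (le_inv_comm₀ hκ hk0).mp h1
  rw [hr] at hle
  have hnorm : ‖((u⁻¹ : (H →L[ℂ] H)ˣ) : H →L[ℂ] H)‖ ≤ κ⁻¹ := by
    rw [← ENNReal.ofReal_le_ofReal_iff (by positivity), ← coe_nnnorm,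
      ENNReal.ofReal_coe_nnreal]
    exact hle
  have hx : x = ((u⁻¹ : (H →L[ℂ] H)ˣ) : H →L[ℂ] H) ((u : H →L[ℂ] H) x) := by
    rw [← mul_apply_eq_comp, Units.inv_mul, one_apply_eq_self]
  have hux : ‖(u : H →L[ℂ] H) x‖ = ‖U x - z • x‖ := by
    rw [hu, norm_sub_rev]
    simp [Algebra.algebraMap_eq_smul_one]
  have h2 := ((u⁻¹ : (H →L[ℂ] H)ˣ) : H →L[ℂ] H).le_of_opNorm_le hnorm ((u : H →L[ℂ] H) x)
  rw [← hx, hux, ← div_eq_inv_mul, le_div_iff₀ hκ] at h2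
  linarith

end Spectrum

theorem spectrum_subset_roots {A : Type*} [Ring A] [Algebra ℂ A] {a : A}
    {p : Polynomial ℂ} (hp : p ≠ 0) (h : Polynomial.aeval a p = 0) :
    spectrum ℂ a ⊆ p.roots.toFinset := by
  rcases subsingleton_or_nontrivial A with hA | hA
  · rw [spectrum.of_subsingleton]; exact Set.empty_subset _
  intro s hs
  have h1 := spectrum.subset_polynomial_aeval a p ⟨s, hs, rfl⟩
  rw [h, spectrum.zero_eq] at h1
  simpa [hp] using h1

/-! ### Arc length -/

theorem volume_exp_near_le (s : ℂ) {κ : ℝ} (hκ : 0 ≤ κ) :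
    MeasureTheory.volume {θ : ℝ | θ ∈ Set.Ioc (-Real.pi) Real.pi ∧
      ‖Complex.exp (θ * Complex.I) - s‖ ≤ κ} ≤ ENNReal.ofReal (6 * Real.pi * κ) := by
  set S := {θ : ℝ | θ ∈ Set.Ioc (-Real.pi) Real.pi ∧ ‖Complex.exp (θ * Complex.I) - s‖ ≤ κ}
  rcases S.eq_empty_or_nonempty with h | ⟨t, ht⟩
  · rw [h]; simp
  have hπ := Real.pi_pos
  -- Jordan's inequality for `sin (x / 2)` compares the chord with the arc.
  have key : ∀ x : ℝ, |x| ≤ Real.pi → ‖Complex.exp (x * Complex.I) - 1‖ ≤ 2 * κ →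
      |x| ≤ Real.pi * κ := by
    intro x hx h
    rw [mul_comm, Complex.norm_exp_I_mul_ofReal_sub_one, norm_mul, Real.norm_eq_abs,
      Real.norm_eq_abs, abs_two] at h
    have h1 := Real.mul_abs_le_abs_sin (x := x / 2) (by rw [abs_div, abs_two]; linarith)
    rw [abs_div, abs_two] at h1
    have h2 : 2 / Real.pi * (|x| / 2) ≤ κ := by linarith
    have h3 : 2 / Real.pi * (|x| / 2) = |x| / Real.pi := by field_simp
    rw [h3, div_le_iff₀ hπ] at h2
    linarith
  -- Two points of `S` are within chord `2 * κ`, but their arguments may differ by nearly `±2π`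
  -- across the cut at `π`. Hence three intervals, each of length `2πκ`.
  have hsub : S ⊆ (Set.Icc (t - Real.pi * κ) (t + Real.pi * κ)
      ∪ Set.Icc (t - 2 * Real.pi - Real.pi * κ) (t - 2 * Real.pi + Real.pi * κ))
      ∪ Set.Icc (t + 2 * Real.pi - Real.pi * κ) (t + 2 * Real.pi + Real.pi * κ) := by
    intro θ hθ
    have hd : ∀ n : ℤ, ‖Complex.exp (((θ - t + n * (2 * Real.pi) : ℝ) : ℂ) * Complex.I) - 1‖
        ≤ 2 * κ := by
      intro n
      have e : Complex.exp (((θ - t + n * (2 * Real.pi) : ℝ) : ℂ) * Complex.I)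
          = Complex.exp (θ * Complex.I) / Complex.exp (t * Complex.I) := by
        rw [← Complex.exp_sub, Complex.exp_eq_exp_iff_exists_int]
        exact ⟨n, by push_cast; ring⟩
      have h1 : ‖Complex.exp (t * Complex.I)‖ = 1 := Complex.norm_exp_ofReal_mul_I t
      have h2 : Complex.exp (θ * Complex.I) / Complex.exp (t * Complex.I) - 1
          = (Complex.exp (θ * Complex.I) - Complex.exp (t * Complex.I))
            / Complex.exp (t * Complex.I) := by
        rw [sub_div, div_self (Complex.exp_ne_zero _)]
      rw [e, h2, norm_div, h1, div_one]
      calc _ = ‖(Complex.exp (θ * Complex.I) - s) - (Complex.exp (t * Complex.I) - s)‖ := by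
            rw [sub_sub_sub_cancel_right]
        _ ≤ _ := (norm_sub_le _ _).trans (by linarith [hθ.2, ht.2])
    have hθ1 := hθ.1.1
    have hθ2 := hθ.1.2
    have ht1 := ht.1.1
    have ht2 := ht.1.2
    by_cases h1 : |θ - t| ≤ Real.pi
    · have := abs_le.mp (key (θ - t) h1 (by simpa using hd 0))
      exact Or.inl (Or.inl ⟨by linarith, by linarith⟩)
    · rcases le_or_gt 0 (θ - t) with h0 | h0
      · rw [abs_of_nonneg h0, not_le] at h1
        have := abs_le.mp (key _ (by rw [abs_le]; push_cast; constructor <;> linarith) (hd (-1)))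
        push_cast at this
        exact Or.inr ⟨by linarith, by linarith⟩
      · rw [abs_of_neg h0, not_le] at h1
        have := abs_le.mp (key _ (by rw [abs_le]; push_cast; constructor <;> linarith) (hd 1))
        push_cast at this
        exact Or.inl (Or.inr ⟨by linarith, by linarith⟩)
  refine (MeasureTheory.measure_mono hsub).trans ?_
  refine (MeasureTheory.measure_union_le _ _).trans
    ((add_le_add_left (MeasureTheory.measure_union_le _ _) _).trans ?_)
  have hκ' : 0 ≤ Real.pi * κ := by positivity
  rw [Real.volume_Icc, Real.volume_Icc, Real.volume_Icc, ← ENNReal.ofReal_add, ← ENNReal.ofReal_add]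
  · refine ENNReal.ofReal_le_ofReal ?_
    linarith
  all_goals linarith

/-- A set whose points on the circle are near finitely many points has small arc length. -/
theorem circleLeb_le_of_near {S : Set ℂ} {ι : Type*} (J : Finset ι) (R : ι → Finset ℂ) {P : ℕ}
    (hR : ∀ j ∈ J, (R j).card ≤ P) {κ : ℝ} (hκ : 0 ≤ κ)
    (hS : ∀ z ∈ S, ‖z‖ = 1 → ∃ j ∈ J, ∃ s ∈ R j, ‖z - s‖ ≤ κ) :
    circleLeb S ≤ ENNReal.ofReal (J.card * (P * (6 * Real.pi * κ))) := by
  have hπ := Real.pi_pos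
  have hsub : {θ : ℝ | θ ∈ Set.Ioc (-Real.pi) Real.pi ∧ Complex.exp (θ * Complex.I) ∈ S}
      ⊆ ⋃ j ∈ J, ⋃ s ∈ R j, {θ : ℝ | θ ∈ Set.Ioc (-Real.pi) Real.pi ∧
      ‖Complex.exp (θ * Complex.I) - s‖ ≤ κ} := by
    intro θ hθ
    obtain ⟨j, hj, s, hs, h⟩ := hS _ hθ.2 (Complex.norm_exp_ofReal_mul_I θ)
    simp only [Set.mem_iUnion]
    exact ⟨j, hj, s, hs, hθ.1, h⟩
  refine (MeasureTheory.measure_mono hsub).trans ?_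
  refine (MeasureTheory.measure_biUnion_finset_le _ _).trans ?_
  calc _ ≤ ∑ j ∈ J, ENNReal.ofReal (P * (6 * Real.pi * κ)) := by
        refine Finset.sum_le_sum fun j hj => ?_
        refine (MeasureTheory.measure_biUnion_finset_le _ _).trans ?_
        refine (Finset.sum_le_sum fun s _ => volume_exp_near_le s hκ).trans ?_
        rw [Finset.sum_const, nsmul_eq_mul, ENNReal.ofReal_mul (Nat.cast_nonneg _),
          ENNReal.ofReal_natCast]
        gcongr
        exact hR j hj
    _ = _ := by
        rw [Finset.sum_const, nsmul_eq_mul, ENNReal.ofReal_mul (Nat.cast_nonneg J.card),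
          ENNReal.ofReal_natCast]

/-! ### Semicontinuity of the spectrum -/

theorem isOpen_setOf_spectrum_subset {A : Type*} [NormedRing A] [NormedAlgebra ℂ A]
    [CompleteSpace A] {V : Set ℂ} (hV : IsOpen V) :
    IsOpen {a : A | ∀ z ∈ spectrum ℂ a, ‖z‖ = 1 → z ∈ V} := by
  have hopen : IsOpen {p : ℂ × A | IsUnit (algebraMap ℂ A p.1 - p.2)} :=
    Units.isOpen.preimage (by fun_prop)
  have hK : IsCompact (Metric.sphere (0 : ℂ) 1 \ V) := (isCompact_sphere 0 1).diff hV
  rw [isOpen_iff_mem_nhds]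
  intro a ha
  obtain ⟨u, v, -, hv, hu', ha', huv⟩ := generalized_tube_lemma hK
    (isCompact_singleton (x := a)) hopen (by
      rintro ⟨z, b⟩ ⟨⟨hz1, hz2⟩, rfl⟩
      by_contra h
      exact hz2 (ha z h (mem_sphere_zero_iff_norm.mp hz1)))
  filter_upwards [hv.mem_nhds (ha' rfl)] with b hb z hz hz1
  by_contra hzV
  exact hz (huv (show (z, b) ∈ u ×ˢ v from ⟨hu' ⟨by simpa using hz1, hzV⟩, hb⟩))

/-- On measurable sets `circleLeb` is the push-forward of Lebesgue measure on `(-π, π]`, a finite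
Borel measure on `ℂ`, hence outer regular. -/
theorem exists_isOpen_circleLeb_lt {S : Set ℂ} (hS : MeasurableSet S) {d : ℝ≥0∞}
    (h : circleLeb S < d) : ∃ V, IsOpen V ∧ S ⊆ V ∧ circleLeb V < d := by
  have hm : Measurable fun θ : ℝ => Complex.exp (θ * Complex.I) := by fun_prop
  set μ := (MeasureTheory.volume.restrict (Set.Ioc (-Real.pi) Real.pi)).map
    fun θ : ℝ => Complex.exp (θ * Complex.I) with hμ
  have e : ∀ {T : Set ℂ}, MeasurableSet T → μ T = circleLeb T := by
    intro T hT
    rw [hμ, MeasureTheory.Measure.map_apply hm hT,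
      MeasureTheory.Measure.restrict_apply (hm hT), Set.inter_comm]
    rfl
  rw [← e hS] at h
  obtain ⟨V, hSV, hV, hlt⟩ := S.exists_isOpen_lt_of_lt d h
  exact ⟨V, hV, hSV, e hV.measurableSet ▸ hlt⟩

theorem circleLeb_mono_on_circle {S T : Set ℂ} (h : ∀ z ∈ S, ‖z‖ = 1 → z ∈ T) :
    circleLeb S ≤ circleLeb T :=
  MeasureTheory.measure_mono fun θ hθ => ⟨hθ.1, h _ hθ.2 (Complex.norm_exp_ofReal_mul_I θ)⟩

theorem isOpen_thinSpectrum (δ : ℝ) : IsOpen (thinSpectrum δ) := by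
  rw [isOpen_iff_mem_nhds]
  intro E hE
  obtain ⟨V, hV, hSV, hlt⟩ := exists_isOpen_circleLeb_lt
    (spectrum.isClosed (𝕜 := ℂ) (E : ℓ²(ℤ, ℂ) →L[ℂ] ℓ²(ℤ, ℂ))).measurableSet hE
  have ho := (isOpen_setOf_spectrum_subset (A := ℓ²(ℤ, ℂ) →L[ℂ] ℓ²(ℤ, ℂ)) hV).preimage
    (continuous_subtype_val (p := (· ∈ LP)))
  filter_upwards [ho.mem_nhds fun z hz _ => hSV hz] with F hF
  exact (circleLeb_mono_on_circle hF).trans_lt hlt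

/-! ### Restriction to sets of sites, translation -/

/-- The restriction of a square summable sequence to a set of sites. -/
noncomputable def restr (W : Set ℤ) (u : ℓ²(ℤ, ℂ)) : ℓ²(ℤ, ℂ) :=
  ⟨W.indicator u, by
    refine memℓp_gen ?_
    refine Summable.of_nonneg_of_le (fun k => by positivity) (fun k => ?_)
      (lp.memℓp u |>.summable (by norm_num))
    exact Real.rpow_le_rpow (norm_nonneg _) (norm_indicator_le_norm_self _ _) (by norm_num)⟩

theorem restr_apply_of_mem {W : Set ℤ} (u : ℓ²(ℤ, ℂ)) {n : ℤ} (h : n ∈ W) : restr W u n = u n :=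
  Set.indicator_of_mem h _

theorem restr_apply_of_notMem {W : Set ℤ} (u : ℓ²(ℤ, ℂ)) {n : ℤ} (h : n ∉ W) : restr W u n = 0 :=
  Set.indicator_of_notMem h _

theorem restr_norm_sq_add {V W : Set ℤ} (h : V ⊆ W) (u : ℓ²(ℤ, ℂ)) :
    ‖restr (W \ V) u‖ ^ 2 + ‖restr V u‖ ^ 2 = ‖restr W u‖ ^ 2 := by
  refine ((hasSum_sq (restr (W \ V) u)).add (hasSum_sq (restr V u))).unique ?_
  convert hasSum_sq (restr W u) using 2 with n
  by_cases hV : n ∈ V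
  · rw [restr_apply_of_mem u hV, restr_apply_of_mem u (h hV),
      restr_apply_of_notMem u (fun hn => hn.2 hV)]
    simp
  · by_cases hW : n ∈ W
    · rw [restr_apply_of_notMem u hV, restr_apply_of_mem u hW, restr_apply_of_mem u (show n ∈ W \ V from ⟨hW, hV⟩)]
      simp
    · rw [restr_apply_of_notMem u hV, restr_apply_of_notMem u hW,
        restr_apply_of_notMem u (fun hn => hW hn.1)]
      simp

theorem restr_univ (u : ℓ²(ℤ, ℂ)) : restr Set.univ u = u := by
  ext n
  exact restr_apply_of_mem u (Set.mem_univ n)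

theorem restr_norm_sq_le (W : Set ℤ) (u : ℓ²(ℤ, ℂ)) : ‖restr W u‖ ^ 2 ≤ ‖u‖ ^ 2 := by
  have := restr_norm_sq_add (Set.subset_univ W) u
  rw [restr_univ] at this
  nlinarith [sq_nonneg ‖restr (Set.univ \ W) u‖]

theorem shift_aux (a : ℤ) (u : ℓ²(ℤ, ℂ)) : Memℓp (fun n => u (n + a)) 2 := by
  refine memℓp_gen ?_
  have h : Summable fun n => ‖u (n + a)‖ ^ 2 :=
    ((Equiv.addRight a).hasSum_iff.mpr (hasSum_sq u)).summable
  simpa using h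

/-- Translation by `a` on square summable sequences. -/
noncomputable def shift (a : ℤ) : ℓ²(ℤ, ℂ) →L[ℂ] ℓ²(ℤ, ℂ) :=
  LinearMap.mkContinuous
    { toFun := fun u => ⟨fun n => u (n + a), shift_aux a u⟩
      map_add' := fun _ _ => rfl
      map_smul' := fun _ _ => rfl }
    1 (by
      intro u
      have h1 := hasSum_sq ⟨fun n => u (n + a), shift_aux a u⟩
      have h2 := (Equiv.addRight a).hasSum_iff.mpr (hasSum_sq u)
      rw [one_mul]
      exact ((sq_eq_sq₀ (norm_nonneg _) (norm_nonneg _)).mp (h1.unique h2)).le)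

theorem shift_apply (a : ℤ) (u : ℓ²(ℤ, ℂ)) (n : ℤ) : shift a u n = u (n + a) := rfl

theorem norm_shift (a : ℤ) (u : ℓ²(ℤ, ℂ)) : ‖shift a u‖ = ‖u‖ := by
  have h1 := hasSum_sq (shift a u)
  have h2 := (Equiv.addRight a).hasSum_iff.mpr (hasSum_sq u)
  exact (sq_eq_sq₀ (norm_nonneg _) (norm_nonneg _)).mp (h1.unique h2)

/-! ### Exponential decay in a resolvent gap -/

theorem blockFun_congr (p : ℤ) {A B : ℤ → Matrix (Fin 2) (Fin 2) ℂ} {x y : ℤ → ℂ} {n : ℤ}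
    (hA : ∀ m, |m - n| ≤ 1 → A m = B m) (hx : ∀ m, |m - n| ≤ 1 → x m = y m) :
    blockFun p A x n = blockFun p B y n := by
  unfold blockFun
  rw [hA n (by simp), hA (n - 1) (by simp), hx n (by simp), hx (n - 1) (by simp),
    hx (n + 1) (by simp)]

theorem pcmv_apply (α : ℤ → 𝔻) (lam : ℤ → Circle) (x : ℓ²(ℤ, ℂ)) (n : ℤ) :
    pcmv α lam x n = blockFun 0 (fun k => Theta (α k) (lam k))
      (blockFun 1 (fun k => Theta (α k) (lam k)) x) n := rfl

theorem pcmv_apply_congr {α β : ℤ → 𝔻} {lam mu : ℤ → Circle} {x y : ℓ²(ℤ, ℂ)} {n : ℤ}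
    (hc : ∀ m, |m - n| ≤ 2 → α m = β m ∧ lam m = mu m) (hx : ∀ m, |m - n| ≤ 2 → x m = y m) :
    pcmv α lam x n = pcmv β mu y n := by
  rw [pcmv_apply, pcmv_apply]
  have hT : ∀ m, |m - n| ≤ 2 → Theta (α m) (lam m) = Theta (β m) (mu m) := fun m hm => by
    rw [(hc m hm).1, (hc m hm).2]
  refine blockFun_congr 0 (fun m hm => hT m (by linarith)) fun m hm => ?_
  refine blockFun_congr 1 (fun l hl => hT l ?_) fun l hl => hx l ?_ <;>
  · have := abs_sub_le l m n
    linarith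

/-- Test the lower bound for the comparison operator on `f = restr W u`. Away from the edge of `W`,
the vector `(ℰ - z) f` equals the error `w`; near the edge it only sees `e = restr (W \ V) u`, and
it costs at most `2 * ‖e‖` there. Substituting `‖e‖² = ‖f‖² - ‖restr V u‖²` moves the mass on `V` to
the left side. -/
theorem restr_decay_step {α β : ℤ → 𝔻} {lam mu : ℤ → Circle} {V W : Set ℤ}
    (hVW : ∀ n ∈ V, ∀ m, |m - n| ≤ 4 → m ∈ W) (hc : ∀ n ∈ W, α n = β n ∧ lam n = mu n)
    {z : ℂ} (hz : ‖z‖ = 1) {g : ℝ} (hg0 : 0 ≤ g) (hg : ∀ f, g * ‖f‖ ≤ ‖pcmv β mu f - z • f‖)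
    (u : ℓ²(ℤ, ℂ)) :
    (4 + g ^ 2) * ‖restr V u‖ ^ 2 ≤ 4 * ‖restr W u‖ ^ 2 + ‖pcmv α lam u - z • u‖ ^ 2 := by
  set f := restr W u
  set e := restr (W \ V) u
  set w := pcmv α lam u - z • u
  have hsub : V ⊆ W := fun n hn => hVW n hn n (by simp)
  have hpt : ∀ n, ‖(pcmv β mu f - z • f) n‖ ^ 2 ≤ ‖w n‖ ^ 2 + ‖(pcmv β mu e - z • e) n‖ ^ 2 := by
    intro n
    by_cases hn : ∀ m, |m - n| ≤ 2 → m ∈ W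
    · have h1 : pcmv β mu f n = pcmv α lam u n :=
        pcmv_apply_congr (fun m hm => ⟨(hc m (hn m hm)).1.symm, (hc m (hn m hm)).2.symm⟩)
          fun m hm => restr_apply_of_mem u (hn m hm)
      have h2 : f n = u n := restr_apply_of_mem u (hn n (by simp))
      have h3 : (pcmv β mu f - z • f) n = w n := by
        simp only [w, lp.coeFn_sub, lp.coeFn_smul, Pi.sub_apply, Pi.smul_apply, h1, h2]
      rw [h3]
      nlinarith [sq_nonneg ‖(pcmv β mu e - z • e) n‖]
    -- A site outside `W` lies within 2 of `n`, so no site within 2 of `n` can be in `V`. This is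
    -- why the margin is 4, twice the range of the operator.
    · push Not at hn
      obtain ⟨k, hk, hkW⟩ := hn
      have hfe : ∀ m, |m - n| ≤ 2 → f m = e m := by
        intro m hm
        have hmV : m ∉ V := fun hmV => hkW (hVW m hmV k (by
          have := abs_sub_le k n m
          rw [abs_sub_comm n m] at this
          linarith))
        by_cases hmW : m ∈ W
        · rw [restr_apply_of_mem u hmW, restr_apply_of_mem u (show m ∈ W \ V from ⟨hmW, hmV⟩)]
        · rw [restr_apply_of_notMem u hmW, restr_apply_of_notMem u fun h => hmW h.1]
      have h1 : pcmv β mu f n = pcmv β mu e n :=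
        pcmv_apply_congr (fun m hm => ⟨rfl, rfl⟩) hfe
      have h3 : (pcmv β mu f - z • f) n = (pcmv β mu e - z • e) n := by
        simp only [lp.coeFn_sub, lp.coeFn_smul, Pi.sub_apply, Pi.smul_apply, h1, hfe n (by simp)]
      rw [h3]
      nlinarith [sq_nonneg ‖w n‖]
  have hsum := hasSum_le hpt (hasSum_sq _) ((hasSum_sq w).add (hasSum_sq _))
  have he : ‖pcmv β mu e - z • e‖ ≤ 2 * ‖e‖ := by
    refine (norm_sub_le _ _).trans ?_
    rw [norm_apply_of_mem_unitary (pcmv_mem_unitary β mu), norm_smul, hz]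
    linarith
  have he2 : ‖pcmv β mu e - z • e‖ ^ 2 ≤ (2 * ‖e‖) ^ 2 := by gcongr
  have hf2 : (g * ‖f‖) ^ 2 ≤ ‖pcmv β mu f - z • f‖ ^ 2 := by gcongr; exact hg f
  have hadd := restr_norm_sq_add hsub u
  nlinarith [sq_nonneg g, sq_nonneg ‖e‖, mul_nonneg (sq_nonneg g) (sq_nonneg ‖e‖)]

/-- Each nested layer contributes a factor `4 / (4 + g ^ 2) < 1` when `g > 0`, and adds at most one
copy of the squared error. -/
theorem restr_decay {α β : ℤ → 𝔻} {lam mu : ℤ → Circle} {W : ℕ → Set ℤ} {K : ℕ}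
    (hW : ∀ i < K, ∀ n ∈ W (i + 1), ∀ m, |m - n| ≤ 4 → m ∈ W i)
    (hc : ∀ n ∈ W 0, α n = β n ∧ lam n = mu n)
    {z : ℂ} (hz : ‖z‖ = 1) {g : ℝ} (hg0 : 0 ≤ g) (hg : ∀ f, g * ‖f‖ ≤ ‖pcmv β mu f - z • f‖)
    (u : ℓ²(ℤ, ℂ)) :
    ‖restr (W K) u‖ ^ 2 ≤ (4 / (4 + g ^ 2)) ^ K * ‖u‖ ^ 2 + K * ‖pcmv α lam u - z • u‖ ^ 2 := by
  have hsub : ∀ i ≤ K, W i ⊆ W 0 := by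
    intro i
    induction i with
    | zero => exact fun _ => subset_rfl
    | succ i ih => exact fun hi n hn => ih (by omega) (hW i (by omega) n hn n (by simp))
  have hpos : 0 < 4 + g ^ 2 := by positivity
  have hθ : 4 / (4 + g ^ 2) ≤ 1 := by rw [div_le_one hpos]; nlinarith [sq_nonneg g]
  have key : ∀ i ≤ K, ‖restr (W i) u‖ ^ 2
      ≤ (4 / (4 + g ^ 2)) ^ i * ‖u‖ ^ 2 + i * ‖pcmv α lam u - z • u‖ ^ 2 := by
    intro i
    induction i with
    | zero => intro _; simpa using restr_norm_sq_le (W 0) u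
    | succ i ih =>
      intro hi
      have h1 := restr_decay_step (α := α) (lam := lam) (hW i (by omega))
        (fun n hn => hc n (hsub i (by omega) hn)) hz hg0 hg u
      have h2 := ih (by omega)
      set w := ‖pcmv α lam u - z • u‖ ^ 2
      have hw : 0 ≤ w := sq_nonneg _
      have h3 : ‖restr (W (i + 1)) u‖ ^ 2 ≤ (4 / (4 + g ^ 2)) * ‖restr (W i) u‖ ^ 2 + w := by
        have : (4 / (4 + g ^ 2)) * ‖restr (W i) u‖ ^ 2 + w
            = (4 * ‖restr (W i) u‖ ^ 2 + (4 + g ^ 2) * w) / (4 + g ^ 2) := by field_simp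
        rw [this, le_div_iff₀ hpos]
        nlinarith [sq_nonneg g, mul_nonneg (sq_nonneg g) hw]
      refine h3.trans ?_
      have h4 := mul_le_mul_of_nonneg_left h2 (show 0 ≤ 4 / (4 + g ^ 2) by positivity)
      have h5 : 4 / (4 + g ^ 2) * (i * w) ≤ i * w :=
        mul_le_of_le_one_left (by positivity) hθ
      push_cast
      rw [pow_succ (4 / (4 + g ^ 2)) i]
      nlinarith
  exact key K le_rfl

/-! ### Decoupling -/

open Classical in
/-- The blocks `Θ(α k, lam k)`, replaced by the identity at the sites in `S`. -/
noncomputable def cutTheta (S : Set ℤ) (α : ℤ → 𝔻) (lam : ℤ → Circle) (k : ℤ) :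
    Matrix (Fin 2) (Fin 2) ℂ :=
  if k ∈ S then 1 else Theta (α k) (lam k)

theorem norm_cutTheta_le (S : Set ℤ) (α : ℤ → 𝔻) (lam : ℤ → Circle) (k : ℤ) (i j : Fin 2) :
    ‖cutTheta S α lam k i j‖ ≤ 1 := by
  unfold cutTheta
  split_ifs
  · rw [Matrix.one_apply]
    split_ifs <;> simp
  · exact norm_Theta_le _ _ _ _

/-- The pCMV operator with the blocks of the factor `ℳ` at the sites in `S` removed. -/
noncomputable def cutOp (S : Set ℤ) (α : ℤ → 𝔻) (lam : ℤ → Circle) :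
    ℓ²(ℤ, ℂ) →L[ℂ] ℓ²(ℤ, ℂ) :=
  opL α lam * blockOp 1 (cutTheta S α lam) (norm_cutTheta_le S α lam)

theorem cutM_mem_unitary (S : Set ℤ) (α : ℤ → 𝔻) (lam : ℤ → Circle) :
    blockOp 1 (cutTheta S α lam) (norm_cutTheta_le S α lam)
      ∈ unitary (ℓ²(ℤ, ℂ) →L[ℂ] ℓ²(ℤ, ℂ)) := by
  refine blockOp_mem_unitary _ _ _ fun k => ?_
  unfold cutTheta
  split_ifs
  · exact one_mem _
  · exact Theta_mem_unitary _ _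

theorem cutOp_mem_unitary (S : Set ℤ) (α : ℤ → 𝔻) (lam : ℤ → Circle) :
    cutOp S α lam ∈ unitary (ℓ²(ℤ, ℂ) →L[ℂ] ℓ²(ℤ, ℂ)) :=
  mul_mem (blockOp_mem_unitary _ _ _ fun _ => Theta_mem_unitary _ _) (cutM_mem_unitary S α lam)

/-- The two factors `ℳ` differ only in blocks that read the sites of `V`, so `u` may be replaced by
`restr V u`; both factors are then isometric. -/
theorem norm_pcmv_sub_cutOp_le {S V : Set ℤ} (h0 : ∀ n ∈ S, n ∈ V) (h1 : ∀ n ∈ S, n + 1 ∈ V)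
    (α : ℤ → 𝔻) (lam : ℤ → Circle) (u : ℓ²(ℤ, ℂ)) :
    ‖pcmv α lam u - cutOp S α lam u‖ ≤ 2 * ‖restr V u‖ := by
  set M := opM α lam with hM
  set M' := blockOp 1 (cutTheta S α lam) (norm_cutTheta_le S α lam) with hM'
  have e : M u - M' u = M (restr V u) - M' (restr V u) := by
    ext n
    simp only [lp.coeFn_sub, Pi.sub_apply]
    simp only [hM, hM', opM, blockOp_apply, blockFun, cutTheta]
    by_cases hn : Even (n - 1)
    · simp only [if_pos hn]
      by_cases hS : n ∈ S
      · rw [restr_apply_of_mem u (h0 n hS), restr_apply_of_mem u (h1 n hS)]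
      · simp only [if_neg hS, sub_self]
    · simp only [if_neg hn]
      by_cases hS : n - 1 ∈ S
      · have := h1 _ hS
        rw [sub_add_cancel] at this
        rw [restr_apply_of_mem u (h0 _ hS), restr_apply_of_mem u this]
      · simp only [if_neg hS, sub_self]
  have e2 : pcmv α lam u - cutOp S α lam u = opL α lam (M u - M' u) := by
    rw [map_sub]; rfl
  have hL : opL α lam ∈ unitary (ℓ²(ℤ, ℂ) →L[ℂ] ℓ²(ℤ, ℂ)) :=
    blockOp_mem_unitary _ _ _ fun _ => Theta_mem_unitary _ _
  have hMu : M ∈ unitary (ℓ²(ℤ, ℂ) →L[ℂ] ℓ²(ℤ, ℂ)) :=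
    blockOp_mem_unitary _ _ _ fun _ => Theta_mem_unitary _ _
  rw [e2, norm_apply_of_mem_unitary hL, e]
  refine (norm_sub_le _ _).trans ?_
  rw [norm_apply_of_mem_unitary hMu, norm_apply_of_mem_unitary (cutM_mem_unitary S α lam)]
  linarith

/-- If `z` were farther than `3 * r` from the cut spectrum, where `r` is the decay rate to the power
`K`, then the cut operator would be bounded below by `3 * r` at `z`. The cut costs at most `2 * r *
‖u‖` plus a multiple of the error, so `r` survives and `z` would be in the resolvent set. -/
theorem exists_near_of_mem_spectrum {α β : ℤ → 𝔻} {lam mu : ℤ → Circle} {W : ℕ → Set ℤ} {K : ℕ}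
    (hW : ∀ i < K, ∀ n ∈ W (i + 1), ∀ m, |m - n| ≤ 4 → m ∈ W i)
    (hc : ∀ n ∈ W 0, α n = β n ∧ lam n = mu n)
    {S : Set ℤ} (h0 : ∀ n ∈ S, n ∈ W K) (h1 : ∀ n ∈ S, n + 1 ∈ W K)
    {z : ℂ} (hz : ‖z‖ = 1) {g : ℝ} (hg0 : 0 ≤ g) (hg : ∀ f, g * ‖f‖ ≤ ‖pcmv β mu f - z • f‖)
    (hzs : z ∈ spectrum ℂ (pcmv α lam)) :
    ∃ s ∈ spectrum ℂ (cutOp S α lam), ‖z - s‖ ≤ 3 * √(4 / (4 + g ^ 2)) ^ K := by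
  set r := √(4 / (4 + g ^ 2)) ^ K with hr
  have hr0 : 0 < r := by positivity
  have hr2 : (4 / (4 + g ^ 2)) ^ K = r ^ 2 := by
    rw [hr, ← pow_mul, mul_comm K 2, pow_mul, Real.sq_sqrt (by positivity)]
  by_contra! hcon
  refine notMem_spectrum_of_bounded_below (pcmv_mem_unitary α lam) hz
    (c := r / (2 * K + 3)) (by positivity) (fun u => ?_) hzs
  have hd := restr_decay (α := α) (lam := lam) hW hc hz hg0 hg u
  have h2 := norm_pcmv_sub_cutOp_le h0 h1 α lam u
  have h3 := norm_sub_smul_ge_of_mem_unitary (cutOp_mem_unitary S α lam) (κ := 3 * r) (z := z)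
    (by positivity) (fun s hs => (hcon s hs).le) u
  have h4 : ‖cutOp S α lam u - z • u‖
      ≤ ‖pcmv α lam u - z • u‖ + ‖pcmv α lam u - cutOp S α lam u‖ := by
    have : cutOp S α lam u - z • u
        = (pcmv α lam u - z • u) - (pcmv α lam u - cutOp S α lam u) := by abel
    rw [this]
    exact norm_sub_le _ _
  rw [hr2] at hd
  set w := ‖pcmv α lam u - z • u‖
  have hw : 0 ≤ w := norm_nonneg _
  have hu := norm_nonneg u
  have h5 : ‖restr (W K) u‖ ≤ r * ‖u‖ + (K + 1) * w := by
    refine abs_le_of_sq_le_sq' ?_ (by positivity) |>.2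
    have h6 : (0 : ℝ) ≤ (K : ℝ) ^ 2 + K + 1 := by positivity
    have h7 : 0 ≤ 2 * (r * ‖u‖) * ((K + 1) * w) := by positivity
    nlinarith [mul_nonneg h6 (sq_nonneg w)]
  rw [div_mul_eq_mul_div, div_le_iff₀ (by positivity)]
  nlinarith

/-! ### The spectrum of a periodically decoupled operator -/

/-- The sequences that vanish outside `C`. -/
noncomputable def supported (C : Finset ℤ) : Submodule ℂ ℓ²(ℤ, ℂ) where
  carrier := {x | ∀ n ∉ C, x n = 0}
  add_mem' := fun {x y} hx hy n hn => by
    rw [lp.coeFn_add, Pi.add_apply, hx n hn, hy n hn, add_zero]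
  zero_mem' := fun n _ => rfl
  smul_mem' := fun c x hx n hn => by
    rw [lp.coeFn_smul, Pi.smul_apply, hx n hn, smul_zero]

/-- The coordinates of a sequence that vanishes outside `C`. -/
noncomputable def supportedCoord (C : Finset ℤ) : supported C →ₗ[ℂ] (C → ℂ) where
  toFun := fun x n => (x : ℓ²(ℤ, ℂ)) n
  map_add' := fun _ _ => rfl
  map_smul' := fun _ _ => rfl

theorem supportedCoord_injective (C : Finset ℤ) : Function.Injective (supportedCoord C) := by
  intro x y h
  ext n
  by_cases hn : n ∈ C
  · exact congrFun h ⟨n, hn⟩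
  · rw [x.2 n hn, y.2 n hn]

instance (C : Finset ℤ) : FiniteDimensional ℂ (supported C) :=
  FiniteDimensional.of_injective _ (supportedCoord_injective C)

theorem finrank_supported_le (C : Finset ℤ) : Module.finrank ℂ (supported C) ≤ C.card := by
  refine (LinearMap.finrank_le_finrank_of_injective (supportedCoord_injective C)).trans ?_
  simp

theorem aeval_restrict_apply {V : Type*} [AddCommGroup V] [Module ℂ V] {G : Module.End ℂ V}
    {K : Submodule ℂ V} (h : ∀ x ∈ K, G x ∈ K) (p : Polynomial ℂ) (x : K) :
    ((Polynomial.aeval (G.restrict h) p x : K) : V) = Polynomial.aeval G p (x : V) := by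
  induction p using Polynomial.induction_on' with
  | add p q hp hq => simp [hp, hq]
  | monomial n a =>
    have : ∀ n : ℕ, (((G.restrict h) ^ n) x : V) = (G ^ n) (x : V) := by
      intro n
      induction n with
      | zero => rfl
      | succ n ih => rw [pow_succ', pow_succ', Module.End.mul_apply, Module.End.mul_apply, ← ih]; rfl
    simp [Polynomial.aeval_monomial, this, Algebra.algebraMap_eq_smul_one]

theorem aeval_coe_clm {V : Type*} [NormedAddCommGroup V] [NormedSpace ℂ V] (G : V →L[ℂ] V)
    (p : Polynomial ℂ) (x : V) :
    Polynomial.aeval G p x = Polynomial.aeval (G : Module.End ℂ V) p x := by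
  induction p using Polynomial.induction_on' with
  | add p q hp hq => simp [hp, hq]
  | monomial n a =>
    have : ∀ n : ℕ, (G ^ n) x = ((G : Module.End ℂ V) ^ n) x := by
      intro n
      induction n with
      | zero => rfl
      | succ n ih => rw [pow_succ', pow_succ', Module.End.mul_apply, ← ih]; rfl
    simp [Polynomial.aeval_monomial, this, Algebra.algebraMap_eq_smul_one]

/-- The characteristic polynomial of the restriction to one window annihilates the vectors supported
there. By translation it annihilates every basis vector of `ℓ²`, hence it annihilates `G`, and the
spectrum consists of its roots. -/
theorem exists_spectrum_subset_of_commute_shift {G : ℓ²(ℤ, ℂ) →L[ℂ] ℓ²(ℤ, ℂ)} {P : ℕ} (hP : 0 < P)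
    (hG : ∀ c : ℤ, Commute G (shift (c * P))) {k : ℤ}
    (hK : ∀ x ∈ supported (Finset.Ioc k (k + P)), G x ∈ supported (Finset.Ioc k (k + P))) :
    ∃ R : Finset ℂ, R.card ≤ P ∧ spectrum ℂ G ⊆ R := by
  set C := Finset.Ioc k (k + P)
  set T : Module.End ℂ (supported C) := (G : Module.End ℂ ℓ²(ℤ, ℂ)).restrict hK
  refine ⟨T.charpoly.roots.toFinset, ?_, spectrum_subset_roots T.charpoly_monic.ne_zero ?_⟩
  · refine (Multiset.toFinset_card_le _).trans ((Polynomial.card_roots' _).trans ?_)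
    rw [LinearMap.charpoly_natDegree]
    refine (finrank_supported_le C).trans ?_
    simp [C]
  · have hzero : ∀ x ∈ supported C, Polynomial.aeval G T.charpoly x = 0 := by
      intro x hx
      rw [aeval_coe_clm, ← aeval_restrict_apply hK T.charpoly ⟨x, hx⟩,
        LinearMap.aeval_self_charpoly]
      rfl
    have hsingle : ∀ (n : ℤ) (a : ℂ), Polynomial.aeval G T.charpoly (lp.single 2 n a) = 0 := by
      intro n a
      set c := (n - k - 1) / P
      set r := (n - k - 1) % P
      have hr : r + P * c = n - k - 1 := Int.emod_add_mul_ediv _ _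
      have hr0 : 0 ≤ r := Int.emod_nonneg _ (by omega)
      have hr1 : r < P := Int.emod_lt_of_pos _ (by omega)
      have e : lp.single 2 n a = shift ((-c : ℤ) * P) (lp.single 2 (k + 1 + r) a) := by
        ext m
        rw [shift_apply]
        by_cases hm : m = n
        · have : m + (-c) * P = k + 1 + r := by rw [hm]; linarith
          rw [this, hm, lp.single_apply_self, lp.single_apply_self]
        · have : m + (-c) * P ≠ k + 1 + r := fun h => hm (by linarith)
          rw [lp.single_apply_ne _ _ _ hm, lp.single_apply_ne _ _ _ this]
      have hcomm : Commute (Polynomial.aeval G T.charpoly) (shift ((-c : ℤ) * P)) :=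
        (Algebra.commute_of_mem_adjoin_singleton_of_commute
          (Polynomial.aeval_mem_adjoin_singleton ℂ G) (hG (-c)).symm).symm
      rw [e, ← mul_apply_eq_comp, hcomm.eq, mul_apply_eq_comp, hzero, map_zero]
      intro m hm
      rw [lp.single_apply_ne]
      rintro rfl
      exact hm (by simp only [C, Finset.mem_Ioc]; omega)
    ext x : 1
    have h1 := (lp.hasSum_single (by norm_num) x).mapL (Polynomial.aeval G T.charpoly)
    simp only [hsingle] at h1
    exact h1.unique hasSum_zero

theorem blockOp_commute_shift (p : ℤ) {A : ℤ → Matrix (Fin 2) (Fin 2) ℂ}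
    (hA : ∀ k i j, ‖A k i j‖ ≤ 1) {a : ℤ} (ha : Even a) (hper : ∀ k, A (k + a) = A k) :
    Commute (blockOp p A hA) (shift a) := by
  ext x n
  rw [mul_apply_eq_comp, mul_apply_eq_comp, shift_apply, blockOp_apply, blockOp_apply]
  unfold blockFun
  have h1 : Even (n + a - p) ↔ Even (n - p) := by grind
  simp only [h1, shift_apply, hper]
  have h2 : n + a - 1 = n - 1 + a := by ring
  have h3 : n + a + 1 = n + 1 + a := by ring
  rw [h2, h3, hper]

/-- For odd `k` the window `(k, k + P]` starts at an even site and ends at an odd one. The blocks of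
`ℒ` do not cross its ends, and the two blocks of `ℳ` that do are exactly the ones removed. -/
theorem exists_spectrum_cutOp_subset {α : ℤ → 𝔻} {lam : ℤ → Circle} {P : ℕ} (hP : 0 < P)
    (hPe : Even P) (hper : ∀ n : ℤ, α (n + P) = α n ∧ lam (n + P) = lam n) {k : ℤ} (hk : Odd k) :
    ∃ R : Finset ℂ, R.card ≤ P ∧
      spectrum ℂ (cutOp {n | ∃ c : ℤ, n = k + c * P} α lam) ⊆ R := by
  set S : Set ℤ := {n | ∃ c : ℤ, n = k + c * P} with hS
  have hα : Function.Periodic α (P : ℤ) := fun n => (hper n).1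
  have hlam : Function.Periodic lam (P : ℤ) := fun n => (hper n).2
  have hPe' : Even (P : ℤ) := by exact_mod_cast hPe
  have hΘ : ∀ (c n : ℤ), Theta (α (n + c * P)) (lam (n + c * P)) = Theta (α n) (lam n) := by
    intro c n
    have h1 := hα.int_mul c n
    have h2 := hlam.int_mul c n
    rw [Int.cast_id] at h1 h2
    rw [h1, h2]
  have hSper : ∀ (c n : ℤ), n + c * P ∈ S ↔ n ∈ S := by
    intro c n
    constructor
    · rintro ⟨d, hd⟩
      exact ⟨d - c, by linear_combination hd⟩
    · rintro ⟨d, hd⟩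
      exact ⟨d + c, by linear_combination hd⟩
  refine exists_spectrum_subset_of_commute_shift hP (fun c => ?_) (k := k) fun x hx => ?_
  · have hce : Even (c * P) := hPe'.mul_left c
    refine Commute.mul_left (blockOp_commute_shift 0 _ hce (hΘ c))
      (blockOp_commute_shift 1 _ hce fun n => ?_)
    have h := hSper c n
    unfold cutTheta
    by_cases hn : n ∈ S
    · rw [if_pos hn, if_pos (h.mpr hn)]
    · rw [if_neg hn, if_neg (mt h.mp hn), hΘ]
  · have hM : blockOp 1 (cutTheta S α lam) (norm_cutTheta_le S α lam) x
        ∈ supported (Finset.Ioc k (k + P)) := by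
      intro n hn
      have hxn := hx n hn
      rw [blockOp_apply]
      unfold blockFun
      split_ifs with he
      · by_cases hnS : n ∈ S
        · simp [cutTheta, if_pos hnS, hxn]
        · have : x (n + 1) = 0 := by
            refine hx _ fun h => ?_
            rw [Finset.mem_Ioc] at h hn
            exact hnS ⟨0, by omega⟩
          rw [hxn, this, mul_zero, mul_zero, add_zero]
      · by_cases hnS : n - 1 ∈ S
        · simp [cutTheta, if_pos hnS, hxn]
        · have : x (n - 1) = 0 := by
            refine hx _ fun h => ?_
            rw [Finset.mem_Ioc] at h hn
            exact hnS ⟨1, by omega⟩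
          rw [hxn, this, mul_zero, mul_zero, add_zero]
    generalize hy : blockOp 1 (cutTheta S α lam) (norm_cutTheta_le S α lam) x = y at hM
    rw [cutOp, mul_apply_eq_comp, hy]
    intro n hn
    have hyn := hM n hn
    rw [opL, blockOp_apply]
    unfold blockFun
    split_ifs with he
    · have : y (n + 1) = 0 := by
        refine hM _ fun h => ?_
        rw [Finset.mem_Ioc] at h hn
        grind
      rw [hyn, this, mul_zero, mul_zero, add_zero]
    · have : y (n - 1) = 0 := by
        refine hM _ fun h => ?_
        rw [Finset.mem_Ioc] at h hn
        grind
      rw [hyn, this, mul_zero, mul_zero, add_zero]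

/-! ### Transfer matrices -/

section Cocycle

variable {R : Type*} [CommRing R]

/-- The product `T (n + J - 1) * ⋯ * T n`. -/
def cocycle (T : ℤ → Matrix (Fin 2) (Fin 2) R) (n : ℤ) : ℕ → Matrix (Fin 2) (Fin 2) R
  | 0 => 1
  | J + 1 => T (n + J) * cocycle T n J

theorem cocycle_congr {T T' : ℤ → Matrix (Fin 2) (Fin 2) R} {n n' : ℤ} {J : ℕ}
    (h : ∀ i < J, T (n + i) = T' (n' + i)) : cocycle T n J = cocycle T' n' J := by
  induction J with
  | zero => rfl
  | succ J ih => rw [cocycle, cocycle, h J (by omega), ih fun i hi => h i (by omega)]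

theorem cocycle_add (T : ℤ → Matrix (Fin 2) (Fin 2) R) (n : ℤ) (I J : ℕ) :
    cocycle T n (I + J) = cocycle T (n + I) J * cocycle T n I := by
  induction J with
  | zero => simp [cocycle]
  | succ J ih =>
    rw [← add_assoc, cocycle, cocycle, ih, mul_assoc]
    congr 2
    push_cast
    ring

theorem cocycle_succ' (T : ℤ → Matrix (Fin 2) (Fin 2) R) (n : ℤ) (J : ℕ) :
    cocycle T n (J + 1) = cocycle T (n + 1) J * T n := by
  rw [add_comm, cocycle_add]
  simp [cocycle]

theorem det_cocycle {T : ℤ → Matrix (Fin 2) (Fin 2) R} (hT : ∀ n, (T n).det = -1) (n : ℤ) {J : ℕ}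
    (hJ : Even J) : (cocycle T n J).det = 1 := by
  have h : ∀ J : ℕ, (cocycle T n J).det = (-1) ^ J := by
    intro J
    induction J with
    | zero => simp [cocycle]
    | succ J ih => rw [cocycle, Matrix.det_mul, hT, ih, pow_succ']
  rw [h, hJ.neg_one_pow]

/-- Monodromy matrices with consecutive base points are conjugate by `T n`. -/
theorem trace_cocycle_eq {T : ℤ → Matrix (Fin 2) (Fin 2) R} (hT : ∀ n, (T n).det = -1) {Q : ℕ}
    (hper : ∀ n, T (n + Q) = T n) (n : ℤ) :
    (cocycle T n Q).trace = (cocycle T 1 Q).trace := by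
  have hstep : ∀ n, (cocycle T (n + 1) Q).trace = (cocycle T n Q).trace := by
    intro n
    have hu : IsUnit (T n).det := by rw [hT]; exact isUnit_one.neg
    have h : cocycle T (n + 1) Q * T n = T n * cocycle T n Q := by
      rw [← cocycle_succ', cocycle, hper]
    have h2 : cocycle T (n + 1) Q = T n * cocycle T n Q * (T n)⁻¹ := by
      rw [← h, mul_assoc, Matrix.mul_nonsing_inv _ hu, mul_one]
    rw [h2, Matrix.trace_mul_comm, ← mul_assoc, Matrix.nonsing_inv_mul _ hu, one_mul]
  induction n using Int.induction_on with
  | zero => exact (hstep 0).symm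
  | succ i ih => rw [hstep, ih]
  | pred i ih => rw [← hstep, sub_add_cancel, ih]

theorem mul_self_eq_trace_smul_sub {A : Matrix (Fin 2) (Fin 2) R} (h : A.det = 1) :
    A * A = A.trace • A - 1 := by
  rw [Matrix.det_fin_two] at h
  ext i j
  fin_cases i <;> fin_cases j <;>
    simp [Matrix.mul_apply, Fin.sum_univ_two, Matrix.trace_fin_two] <;> grind

end Cocycle

/-! ### Three-term recurrence over two periods -/

section GapCriterion

open Matrix

theorem norm_cocycle_mulVec_le {T : ℤ → Matrix (Fin 2) (Fin 2) ℂ} {B : ℝ}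
    (hB : ∀ n x, ‖T n *ᵥ x‖ ≤ B * ‖x‖) (hB0 : 0 ≤ B) (n : ℤ) (J : ℕ) (x : Fin 2 → ℂ) :
    ‖cocycle T n J *ᵥ x‖ ≤ B ^ J * ‖x‖ := by
  induction J with
  | zero => simp [cocycle]
  | succ J ih =>
    rw [cocycle, ← mulVec_mulVec, pow_succ', mul_assoc]
    exact (hB _ _).trans (mul_le_mul_of_nonneg_left ih hB0)

/-- Propagation of errors in a perturbed linear recurrence. -/
theorem exists_cocycle_error_bound {T : ℤ → Matrix (Fin 2) (Fin 2) ℂ} {B C : ℝ}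
    (hB : ∀ n x, ‖T n *ᵥ x‖ ≤ B * ‖x‖) (hB0 : 0 ≤ B) (hC0 : 0 ≤ C) (J : ℕ) :
    ∃ D : ℝ, 0 ≤ D ∧ ∀ (X : ℤ → Fin 2 → ℂ) (h : ℤ → ℝ), (∀ n, 0 ≤ h n) →
      (∀ n, ‖X (n + 1) - T n *ᵥ X n‖ ≤ C * (h n + h (n + 1))) →
      ∀ n, ‖X (n + J) - cocycle T n J *ᵥ X n‖ ≤ D * ∑ i ∈ Finset.range (J + 1), h (n + i) := by
  induction J with
  | zero => exact ⟨0, le_rfl, fun X h _ _ n => by simp [cocycle]⟩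
  | succ J ih =>
    obtain ⟨D, hD0, hD⟩ := ih
    refine ⟨2 * C + B * D, by positivity, fun X h hh hX n => ?_⟩
    have h1 := hD X h hh hX n
    have h2 := hX (n + J)
    set s := ∑ i ∈ Finset.range (J + 1), h (n + i)
    have hs0 : 0 ≤ s := Finset.sum_nonneg fun i _ => hh _
    have hsJ : h (n + J) ≤ s :=
      Finset.single_le_sum (f := fun i : ℕ => h (n + i)) (fun i _ => hh _) (by simp)
    have e : X (n + (J + 1 : ℕ)) - cocycle T n (J + 1) *ᵥ X n
        = (X (n + J + 1) - T (n + J) *ᵥ X (n + J))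
          + T (n + J) *ᵥ (X (n + J) - cocycle T n J *ᵥ X n) := by
      rw [mulVec_sub, mulVec_mulVec, cocycle]
      push_cast
      rw [← add_assoc]
      abel
    have h3 := (hB (n + J) _).trans (mul_le_mul_of_nonneg_left h1 hB0)
    rw [e, Finset.sum_range_succ]
    refine (norm_add_le _ _).trans ((add_le_add h2 h3).trans ?_)
    push_cast
    rw [← add_assoc]
    have := hh (n + J + 1)
    have h5 : 0 ≤ B * D * h (n + J + 1) := by positivity
    have h6 := mul_le_mul_of_nonneg_left hsJ hC0
    have h7 : 0 ≤ C * h (n + J + 1) := by positivity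
    have h8 : 0 ≤ C * s := by positivity
    nlinarith

/-- The monodromy matrix `A` is the same at `n` and `n + Q`, so `A * A = t • A - 1` gives the
recurrence for exact solutions, and the inexact one inherits the error. Only the trace enters, so no
eigenvectors are needed. -/
theorem exists_three_term_bound {T : ℤ → Matrix (Fin 2) (Fin 2) ℂ} {B C : ℝ}
    (hB : ∀ n x, ‖T n *ᵥ x‖ ≤ B * ‖x‖) (hB0 : 0 ≤ B) (hC0 : 0 ≤ C) {Q : ℕ}
    (hper : ∀ n, T (n + Q) = T n) (hdet : ∀ n, (cocycle T n Q).det = 1) {t : ℂ}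
    (htr : ∀ n, (cocycle T n Q).trace = t) :
    ∃ D : ℝ, 0 ≤ D ∧ ∀ (X : ℤ → Fin 2 → ℂ) (h : ℤ → ℝ), (∀ n, 0 ≤ h n) →
      (∀ n, ‖X (n + 1) - T n *ᵥ X n‖ ≤ C * (h n + h (n + 1))) →
      ∀ n, ‖X (n + Q + Q) - t • X (n + Q) + X n‖
        ≤ D * ∑ i ∈ Finset.range (Q + Q + 1), h (n + i) := by
  obtain ⟨D, hD0, hD⟩ := exists_cocycle_error_bound hB hB0 hC0 Q
  refine ⟨D + (B ^ Q + ‖t‖) * D, by positivity, fun X h hh hX n => ?_⟩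
  set A := cocycle T n Q
  have hA : cocycle T (n + Q) Q = A := cocycle_congr fun i _ => by
    rw [add_right_comm, hper]
  have h1 := hD X h hh hX n
  have h2 := hD X h hh hX (n + Q)
  rw [hA] at h2
  have hAA : A * A = t • A - 1 := by rw [← htr n]; exact mul_self_eq_trace_smul_sub (hdet n)
  set Y := X (n + Q) - A *ᵥ X n
  have e : X (n + Q + Q) - t • X (n + Q) + X n
      = (X (n + Q + Q) - A *ᵥ X (n + Q)) + (A *ᵥ Y - t • Y) := by
    simp only [Y, mulVec_sub, mulVec_mulVec, hAA, sub_mulVec, smul_mulVec, one_mulVec, smul_sub]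
    abel
  set s := ∑ i ∈ Finset.range (Q + Q + 1), h (n + i)
  have hs1 : ∑ i ∈ Finset.range (Q + 1), h (n + i) ≤ s :=
    Finset.sum_le_sum_of_subset_of_nonneg (Finset.range_mono (by omega)) fun i _ _ => hh _
  have hs2 : ∑ i ∈ Finset.range (Q + 1), h (n + Q + i) ≤ s := by
    have e : s = ∑ i ∈ Finset.range (Q + (Q + 1)), h (n + i) := by simp only [s, add_assoc]
    rw [e, Finset.sum_range_add (fun i : ℕ => h (n + i)) Q (Q + 1)]
    refine le_add_of_nonneg_of_le (Finset.sum_nonneg fun i _ => hh _) (le_of_eq ?_)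
    refine Finset.sum_congr rfl fun i _ => ?_
    push_cast
    rw [add_assoc]
  have h3 : ‖Y‖ ≤ D * s := h1.trans (mul_le_mul_of_nonneg_left hs1 hD0)
  have h4 := h2.trans (mul_le_mul_of_nonneg_left hs2 hD0)
  have h5 : ‖A *ᵥ Y - t • Y‖ ≤ (B ^ Q + ‖t‖) * ‖Y‖ := by
    refine (norm_sub_le _ _).trans ?_
    rw [norm_smul, add_mul]
    exact add_le_add (norm_cocycle_mulVec_le hB hB0 n Q Y) le_rfl
  rw [e]
  refine (norm_add_le _ _).trans ?_
  have h6 := h5.trans (mul_le_mul_of_nonneg_left h3 (by positivity))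
  linarith

theorem lp_norm_mono {x y : ℓ²(ℤ, ℂ)} (h : ∀ n, ‖x n‖ ≤ ‖y n‖) : ‖x‖ ≤ ‖y‖ := by
  refine le_of_sq_le_sq ?_ (norm_nonneg _)
  exact hasSum_le (fun n => by gcongr; exact h n) (hasSum_sq x) (hasSum_sq y)

/-- The window sum is a sum of `J` translates of `‖h‖`, each of norm `‖h‖` in `ℓ²`. -/
theorem norm_le_of_window_bound {x h : ℓ²(ℤ, ℂ)} {D : ℝ} (hD : 0 ≤ D) {J : ℕ}
    (hx : ∀ n : ℤ, ‖x n‖ ≤ D * ∑ i ∈ Finset.range J, ‖h (n + i)‖) : ‖x‖ ≤ D * (J * ‖h‖) := by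
  have hm : Memℓp (fun n => ((‖h n‖ : ℝ) : ℂ)) 2 := by
    refine memℓp_gen ?_
    simpa using (hasSum_sq h).summable
  set k : ℓ²(ℤ, ℂ) := ⟨fun n => ((‖h n‖ : ℝ) : ℂ), hm⟩ with hk
  have hkn : ∀ n, k n = ((‖h n‖ : ℝ) : ℂ) := fun _ => rfl
  have hkh : ‖k‖ ≤ ‖h‖ := lp_norm_mono fun n => by rw [hkn]; simp
  set y : ℓ²(ℤ, ℂ) := (D : ℂ) • ∑ i ∈ Finset.range J, shift i k with hy
  have hyn : ∀ n : ℤ, y n = ((D * ∑ i ∈ Finset.range J, ‖h (n + i)‖ : ℝ) : ℂ) := by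
    intro n
    rw [hy, lp.coeFn_smul, Pi.smul_apply, lp.coeFn_sum, Finset.sum_apply, smul_eq_mul]
    simp only [shift_apply, hkn]
    push_cast
    rfl
  refine (lp_norm_mono (y := y) fun n => ?_).trans ?_
  · rw [hyn, Complex.norm_real]
    exact (hx n).trans (le_abs_self _)
  · rw [hy, norm_smul, Complex.norm_real, Real.norm_of_nonneg hD]
    refine mul_le_mul_of_nonneg_left ((norm_sum_le _ _).trans ?_) hD
    simp only [norm_shift]
    rw [Finset.sum_const, Finset.card_range, nsmul_eq_mul]
    gcongr

end GapCriterion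

/-! ### Transfer matrices of a pCMV operator and the trace criterion -/

/-- `ρ = √(1 - |α|²)`. -/
noncomputable def rho (α : 𝔻) : ℝ := Real.sqrt (1 - ‖(α : ℂ)‖ ^ 2)

theorem rho_pos (α : 𝔻) : 0 < rho α := by
  have h1 : ‖(α : ℂ)‖ < 1 := α.norm_lt_one
  exact Real.sqrt_pos.mpr (by nlinarith [norm_nonneg (α : ℂ)])

theorem conj_mul_add_rho_sq (α : 𝔻) : conj (α : ℂ) * α + (rho α : ℂ) ^ 2 = 1 :=
  normSq_add_sqrt_sq α

/-- The matrix that transfers `(x, y)` at `k` to `(x', y')` at `k + 1` when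
`Θ(α, lam) (x, x') = (y, y')`. -/
noncomputable def flip (α : 𝔻) (lam : Circle) : Matrix (Fin 2) (Fin 2) ℂ :=
  (rho α : ℂ)⁻¹ • !![-conj (α : ℂ), conj (lam : ℂ); (lam : ℂ), -(α : ℂ)]

theorem flip_spec {α : 𝔻} {lam : Circle} {x x' y y' : ℂ}
    (h1 : Theta α lam 0 0 * x + Theta α lam 0 1 * x' = y)
    (h2 : Theta α lam 1 0 * x + Theta α lam 1 1 * x' = y') :
    x' = flip α lam 0 0 * x + flip α lam 0 1 * y ∧ y' = flip α lam 1 0 * x + flip α lam 1 1 * y := by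
  have hρ : (rho α : ℂ) ≠ 0 := by exact_mod_cast (rho_pos α).ne'
  have hα := conj_mul_add_rho_sq α
  have hl := circle_conj_mul lam
  have hr : Real.sqrt (1 - ‖(α : ℂ)‖ ^ 2) = rho α := rfl
  simp only [Theta, hr, Matrix.smul_apply, Matrix.of_apply, Matrix.cons_val', Matrix.cons_val_zero,
    Matrix.cons_val_one, Matrix.cons_val_fin_one, smul_eq_mul] at h1 h2
  simp only [flip, Matrix.smul_apply, Matrix.of_apply, Matrix.cons_val', Matrix.cons_val_zero,
    Matrix.cons_val_one, Matrix.cons_val_fin_one, smul_eq_mul]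
  rw [← h1, ← h2]
  constructor
  · field_simp
    linear_combination (-conj (α : ℂ) * x - rho α * x') * hl
  · field_simp
    linear_combination x * hα

/-- The one-step transfer matrix of `pcmv α lam` at the spectral parameter `z`, acting on
`(u k, (ℳ u) k)`. -/
noncomputable def transfer (z : ℂ) (α : ℤ → 𝔻) (lam : ℤ → Circle) (k : ℤ) :
    Matrix (Fin 2) (Fin 2) ℂ :=
  if Odd k then flip (α k) (lam k)
  else !![flip (α k) (lam k) 1 1, conj z * flip (α k) (lam k) 1 0;
          z * flip (α k) (lam k) 0 1, flip (α k) (lam k) 0 0]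

theorem det_flip (α : 𝔻) (lam : Circle) : (flip α lam).det = -1 := by
  have hρ : (rho α : ℂ) ≠ 0 := by exact_mod_cast (rho_pos α).ne'
  have hα := conj_mul_add_rho_sq α
  have hl := circle_conj_mul lam
  rw [Matrix.det_fin_two]
  simp only [flip, Matrix.smul_apply, Matrix.of_apply, Matrix.cons_val', Matrix.cons_val_zero,
    Matrix.cons_val_one, Matrix.cons_val_fin_one, smul_eq_mul]
  field_simp
  linear_combination hα - hl

theorem det_transfer {z : ℂ} (hz : conj z * z = 1) (α : ℤ → 𝔻) (lam : ℤ → Circle) (k : ℤ) :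
    (transfer z α lam k).det = -1 := by
  unfold transfer
  split_ifs
  · exact det_flip _ _
  · have := det_flip (α k) (lam k)
    rw [Matrix.det_fin_two] at this
    rw [Matrix.det_fin_two_of]
    linear_combination this - flip (α k) (lam k) 0 1 * flip (α k) (lam k) 1 0 * hz

theorem norm_flip_le (α : 𝔻) (lam : Circle) (i j : Fin 2) : ‖flip α lam i j‖ ≤ (rho α)⁻¹ := by
  have h1 : ‖(α : ℂ)‖ ≤ 1 := α.norm_lt_one.le
  have h0 := (rho_pos α).le
  rw [flip, Matrix.smul_apply, norm_smul, norm_inv, Complex.norm_real, Real.norm_of_nonneg h0]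
  refine mul_le_of_le_one_right (by positivity) ?_
  fin_cases i <;> fin_cases j <;> simp [h1, Circle.norm_coe lam]

theorem norm_mulVec_le_of_entries {A : Matrix (Fin 2) (Fin 2) ℂ} {c : ℝ} (hA : ∀ i j, ‖A i j‖ ≤ c)
    (x : Fin 2 → ℂ) : ‖A.mulVec x‖ ≤ 2 * c * ‖x‖ := by
  have hc : 0 ≤ c := (norm_nonneg _).trans (hA 0 0)
  rw [pi_norm_le_iff_of_nonneg (by positivity)]
  intro i
  rw [Matrix.mulVec, dotProduct, Fin.sum_univ_two]
  refine (norm_add_le _ _).trans ?_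
  rw [norm_mul, norm_mul]
  have h0 := mul_le_mul (hA i 0) (norm_le_pi_norm x 0) (norm_nonneg _) hc
  have h1 := mul_le_mul (hA i 1) (norm_le_pi_norm x 1) (norm_nonneg _) hc
  linarith

theorem norm_transfer_le {z : ℂ} (hz : ‖z‖ = 1) (α : ℤ → 𝔻) (lam : ℤ → Circle) (k : ℤ)
    (i j : Fin 2) : ‖transfer z α lam k i j‖ ≤ (rho (α k))⁻¹ := by
  have := norm_flip_le (α k) (lam k)
  unfold transfer
  split_ifs
  · exact this i j
  · fin_cases i <;> fin_cases j <;> simp [hz, this]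

theorem transfer_periodic {z : ℂ} {α : ℤ → 𝔻} {lam : ℤ → Circle} {Q : ℕ} (hQ : Even Q)
    (hper : ∀ n : ℤ, α (n + Q) = α n ∧ lam (n + Q) = lam n) (n : ℤ) :
    transfer z α lam (n + Q) = transfer z α lam n := by
  have hQ' : Even (Q : ℤ) := by exact_mod_cast hQ
  have h : Odd (n + Q) ↔ Odd n := by grind
  unfold transfer
  simp only [h, (hper n).1, (hper n).2]

theorem exists_le_rho_of_periodic {α : ℤ → 𝔻} {Q : ℕ} (hQ : 0 < Q)
    (hper : ∀ n : ℤ, α (n + Q) = α n) : ∃ B : ℝ, 1 ≤ B ∧ ∀ n, (rho (α n))⁻¹ ≤ B := by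
  have hfin : (Set.range α).Finite := by
    have : Set.range α ⊆ α '' (Set.Ico 0 (Q : ℤ)) := by
      rintro _ ⟨n, rfl⟩
      obtain ⟨m, hm, h⟩ := Function.Periodic.exists_mem_Ico₀ (f := α) (c := (Q : ℤ)) hper
        (by exact_mod_cast hQ) n
      exact ⟨m, hm, h.symm⟩
    exact ((Set.finite_Ico _ _).image α).subset this
  obtain ⟨B, hB⟩ := (hfin.image fun a => (rho a)⁻¹).bddAbove
  exact ⟨max 1 B, le_max_left _ _, fun n =>
    (hB ⟨α n, ⟨n, rfl⟩, rfl⟩).trans (le_max_right _ _)⟩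

/-- The recurrence satisfied by `(u, ℳ u)` when `h = ℰ u - z u`. -/
theorem transfer_error {z : ℂ} (hz : ‖z‖ = 1) (α : ℤ → 𝔻) (lam : ℤ → Circle) {B : ℝ} (hB1 : 1 ≤ B)
    (hB : ∀ n, (rho (α n))⁻¹ ≤ B) (u : ℓ²(ℤ, ℂ)) (n : ℤ) :
    ‖![u (n + 1), opM α lam u (n + 1)] - (transfer z α lam n).mulVec ![u n, opM α lam u n]‖
      ≤ B * (‖(pcmv α lam u - z • u) n‖ + ‖(pcmv α lam u - z • u) (n + 1)‖) := by
  have hzz : conj z * z = 1 := by rw [Complex.conj_mul', hz]; simp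
  set v := opM α lam u with hv
  set h := pcmv α lam u - z • u with hh
  have hn0 := norm_nonneg (h n)
  have hn1 := norm_nonneg (h (n + 1))
  by_cases hn : Odd n
  · have he : Even (n - 1) := by grind
    have he1 : ¬ Even (n + 1 - 1) := by grind
    have h1 : Theta (α n) (lam n) 0 0 * u n + Theta (α n) (lam n) 0 1 * u (n + 1) = v n := by
      rw [hv, opM, blockOp_apply, blockFun, if_pos he]
    have h2 : Theta (α n) (lam n) 1 0 * u n + Theta (α n) (lam n) 1 1 * u (n + 1) = v (n + 1) := by
      rw [hv, opM, blockOp_apply, blockFun, if_neg he1, add_sub_cancel_right]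
    obtain ⟨h3, h4⟩ := flip_spec h1 h2
    have : ![u (n + 1), v (n + 1)] - (transfer z α lam n).mulVec ![u n, v n] = 0 := by
      rw [transfer, if_pos hn]
      ext i
      fin_cases i <;> simp <;>
        rw [sub_eq_zero] <;> assumption
    rw [this, norm_zero]
    have : 0 ≤ B := by linarith
    positivity
  -- At odd sites `v = ℳ u` holds exactly and there is no error. At even sites the block of `ℒ`
  -- sends `v` to `z u + h`, so `flip` acts on `(v, z u + h)`; exchanging the coordinates and
  -- dividing by `z` gives `transfer` plus an error in `h`.
  · have he : Even (n - 0) := by grind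
    have he1 : ¬ Even (n + 1 - 0) := by grind
    have hpc : ∀ m, blockFun 0 (fun k => Theta (α k) (lam k)) v m = z * u m + h m := by
      intro m
      have : h m = blockFun 0 (fun k => Theta (α k) (lam k)) v m - z * u m := rfl
      rw [this]; ring
    have h1 : Theta (α n) (lam n) 0 0 * v n + Theta (α n) (lam n) 0 1 * v (n + 1)
        = z * u n + h n := by
      rw [← hpc, blockFun, if_pos he]
    have h2 : Theta (α n) (lam n) 1 0 * v n + Theta (α n) (lam n) 1 1 * v (n + 1)
        = z * u (n + 1) + h (n + 1) := by
      rw [← hpc, blockFun, if_neg he1, add_sub_cancel_right]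
    obtain ⟨h3, h4⟩ := flip_spec h1 h2
    set F := flip (α n) (lam n) with hF
    have hFB : ∀ i j, ‖F i j‖ ≤ B := fun i j => (norm_flip_le _ _ i j).trans (hB n)
    have e : ![u (n + 1), v (n + 1)] - (transfer z α lam n).mulVec ![u n, v n]
        = ![conj z * (F 1 1 * h n - h (n + 1)), F 0 1 * h n] := by
      rw [transfer, if_neg hn, ← hF]
      ext i
      fin_cases i <;> simp
      · linear_combination conj z * h4 + (F 1 1 * u n - u (n + 1)) * hzz
      · linear_combination h3
    rw [e, pi_norm_le_iff_of_nonneg (by have : 0 ≤ B := by linarith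
                                        positivity)]
    have h11 := mul_le_mul_of_nonneg_right (hFB 1 1) hn0
    have h01 := mul_le_mul_of_nonneg_right (hFB 0 1) hn0
    have hB1' := mul_le_mul_of_nonneg_right hB1 hn1
    intro i
    fin_cases i
    · simp only [Fin.zero_eta, Matrix.cons_val_zero, norm_mul, RCLike.norm_conj, hz, one_mul]
      refine (norm_sub_le _ _).trans ?_
      rw [norm_mul]
      linarith
    · simp only [Fin.mk_one, Matrix.cons_val_one, Matrix.cons_val_fin_one, norm_mul]
      linarith

/-- If the monodromy matrix of a periodic pCMV operator is hyperbolic at `z`, then `ℰ - z` is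
bounded below. -/
theorem exists_bounded_below_of_trace {z : ℂ} (hz : ‖z‖ = 1) {α : ℤ → 𝔻} {lam : ℤ → Circle} {Q : ℕ}
    (hQ0 : 0 < Q) (hQ : Even Q) (hper : ∀ n : ℤ, α (n + Q) = α n ∧ lam (n + Q) = lam n)
    (ht : 2 < ‖(cocycle (transfer z α lam) 1 Q).trace‖) :
    ∃ g : ℝ, 0 < g ∧ ∀ u, g * ‖u‖ ≤ ‖pcmv α lam u - z • u‖ := by
  have hzz : conj z * z = 1 := by rw [Complex.conj_mul', hz]; simp
  obtain ⟨B, hB1, hB⟩ := exists_le_rho_of_periodic hQ0 fun n => (hper n).1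
  set T := transfer z α lam
  set t := (cocycle T 1 Q).trace
  have hTper := transfer_periodic (z := z) hQ hper
  obtain ⟨D, hD0, hD⟩ := exists_three_term_bound (T := T) (B := 2 * B) (C := B)
    (fun n x => norm_mulVec_le_of_entries
      (fun i j => (norm_transfer_le hz α lam n i j).trans (hB n)) x)
    (by linarith) (by linarith) hTper (fun n => det_cocycle (det_transfer hzz α lam) n hQ)
    (t := t) (trace_cocycle_eq (det_transfer hzz α lam) hTper)
  refine ⟨(‖t‖ - 2) / ((D + 1) * (Q + Q + 1)), div_pos (by linarith) (by positivity), fun u => ?_⟩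
  set h := pcmv α lam u - z • u
  have h1 : ‖shift (Q + Q) u - t • shift Q u + u‖ ≤ D * ((Q + Q + 1 : ℕ) * ‖h‖) := by
    refine norm_le_of_window_bound hD0 fun n => ?_
    have h2 := hD (fun m => ![u m, opM α lam u m]) (fun m => ‖h m‖) (fun m => norm_nonneg _)
      (transfer_error hz α lam hB1 hB u) n
    refine le_trans ?_ h2
    have h3 := norm_le_pi_norm (![u (n + Q + Q), opM α lam u (n + Q + Q)]
      - t • ![u (n + Q), opM α lam u (n + Q)] + ![u n, opM α lam u n]) 0
    refine le_trans (le_of_eq ?_) h3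
    change ‖u (n + (Q + Q)) - t * u (n + Q) + u n‖ = _
    simp [add_assoc]
  -- The middle term has norm `‖t‖ * ‖u‖` and the outer two have norm `‖u‖` each, so `‖t‖ > 2`
  -- leaves a positive multiple of `‖u‖`.
  have h2 : ‖t‖ * ‖u‖ - 2 * ‖u‖ ≤ ‖shift (Q + Q) u - t • shift Q u + u‖ := by
    have e : t • shift Q u = shift (Q + Q) u + u - (shift (Q + Q) u - t • shift Q u + u) := by abel
    have h3 : ‖t • shift Q u‖ ≤ ‖u‖ + ‖u‖ + ‖shift (Q + Q) u - t • shift Q u + u‖ := by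
      conv_lhs => rw [e]
      refine (norm_sub_le _ _).trans (add_le_add_left ((norm_add_le _ _).trans ?_) _)
      rw [norm_shift]
    rw [norm_smul, norm_shift] at h3
    linarith
  have hh := norm_nonneg h
  rw [div_mul_eq_mul_div, div_le_iff₀ (by positivity)]
  push_cast at h1
  have : 0 ≤ (Q + Q + 1 : ℝ) * ‖h‖ := by positivity
  nlinarith

open Filter Topology

/-! ### Opening gaps -/

/-- Matrices of the form `!![a, b; conj b, conj a]`. -/
def ConjSymm (A : Matrix (Fin 2) (Fin 2) ℂ) : Prop :=
  A 1 1 = conj (A 0 0) ∧ A 1 0 = conj (A 0 1)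

theorem ConjSymm.one : ConjSymm 1 := by simp [ConjSymm]

theorem ConjSymm.mul {A B : Matrix (Fin 2) (Fin 2) ℂ} (hA : ConjSymm A) (hB : ConjSymm B) :
    ConjSymm (A * B) := by
  simp only [ConjSymm, Matrix.mul_apply, Fin.sum_univ_two, hA.1, hA.2, hB.1, hB.2, map_add, map_mul,
    Complex.conj_conj]
  constructor <;> ring

theorem ConjSymm.flip (α : 𝔻) (lam : Circle) : ConjSymm (flip α lam) := by
  simp [ConjSymm, PCMV.flip]

theorem ConjSymm.transfer (z : ℂ) (α : ℤ → 𝔻) (lam : ℤ → Circle) (k : ℤ) :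
    ConjSymm (transfer z α lam k) := by
  obtain ⟨h1, h2⟩ := ConjSymm.flip (α k) (lam k)
  unfold PCMV.transfer
  split_ifs
  · exact ⟨h1, h2⟩
  · simp [ConjSymm, h1, h2]

theorem ConjSymm.cocycle {T : ℤ → Matrix (Fin 2) (Fin 2) ℂ} (hT : ∀ n, ConjSymm (T n)) (n : ℤ)
    (J : ℕ) : ConjSymm (cocycle T n J) := by
  induction J with
  | zero => exact ConjSymm.one
  | succ J ih => exact (hT _).mul ih

theorem ConjSymm.trace {A : Matrix (Fin 2) (Fin 2) ℂ} (hA : ConjSymm A) :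
    A.trace = ((2 * (A 0 0).re : ℝ) : ℂ) := by
  rw [Matrix.trace_fin_two, hA.1, Complex.add_conj]

/-- The determinant says `|b|² = |a|² + 1`, so `α = -conj a / |b|` lies in the disc and `ρ = 1 /
|b|`; the phase absorbs the argument of `b`. Without phases `b` would have to be positive, and this
freedom would be lost. -/
theorem exists_flip_eq {G : Matrix (Fin 2) (Fin 2) ℂ} (hG : ConjSymm G) (hdet : G.det = -1) :
    ∃ (α : 𝔻) (lam : Circle), flip α lam = G := by
  set a := G 0 0 with ha
  set b := G 0 1 with hb
  have hab : ‖b‖ ^ 2 = ‖a‖ ^ 2 + 1 := by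
    rw [Matrix.det_fin_two, hG.1, hG.2, Complex.mul_conj', Complex.mul_conj'] at hdet
    have : (((‖b‖ ^ 2 : ℝ)) : ℂ) = ((‖a‖ ^ 2 + 1 : ℝ) : ℂ) := by
      push_cast
      linear_combination -hdet
    exact_mod_cast this
  have hb0 : 0 < ‖b‖ := by
    rcases (norm_nonneg b).eq_or_lt with h | h
    · rw [← h] at hab; nlinarith [sq_nonneg ‖a‖]
    · exact h
  have hlt : ‖a‖ < ‖b‖ := by nlinarith [norm_nonneg a]
  have h1 : ‖-conj a / (‖b‖ : ℂ)‖ = ‖a‖ / ‖b‖ := by simp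
  set α : 𝔻 := Complex.UnitDisc.mk (-conj a / (‖b‖ : ℂ)) (by rw [h1, div_lt_one hb0]; exact hlt)
  set lam : Circle := ⟨conj b / (‖b‖ : ℂ), by
    rw [← SetLike.mem_coe, Submonoid.coe_unitSphere, mem_sphere_zero_iff_norm]; simp [hb0.ne']⟩
  have hα : (α : ℂ) = -conj a / (‖b‖ : ℂ) := rfl
  have hl : (lam : ℂ) = conj b / (‖b‖ : ℂ) := rfl
  have hρ : rho α = ‖b‖⁻¹ := by
    rw [rho, hα, h1, Real.sqrt_eq_iff_mul_self_eq_of_pos (by positivity)]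
    field_simp
    linarith
  have hbc : (‖b‖ : ℂ) ≠ 0 := by exact_mod_cast hb0.ne'
  refine ⟨α, lam, ?_⟩
  ext i j
  fin_cases i <;> fin_cases j <;> simp [flip, hρ, hα, hl] <;> field_simp
  · exact ha
  · exact hb
  · exact hG.2.symm
  · exact hG.1.symm

/-- `Θ(α, lam)` as a function of `flip α lam`. -/
noncomputable def thetaOfFlip (G : Matrix (Fin 2) (Fin 2) ℂ) : Matrix (Fin 2) (Fin 2) ℂ :=
  (G 0 1)⁻¹ • !![-G 0 0, 1; 1, G 1 1]

theorem flip_zero_one_ne_zero (α : 𝔻) (lam : Circle) : flip α lam 0 1 ≠ 0 := by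
  have hρ : (rho α : ℂ) ≠ 0 := by exact_mod_cast (rho_pos α).ne'
  simp [flip, hρ]

theorem Theta_eq_thetaOfFlip (α : 𝔻) (lam : Circle) : Theta α lam = thetaOfFlip (flip α lam) := by
  have hρ : (rho α : ℂ) ≠ 0 := by exact_mod_cast (rho_pos α).ne'
  have hl := circle_conj_mul lam
  have hl0 : conj (lam : ℂ) ≠ 0 := by simp
  have hr : Real.sqrt (1 - ‖(α : ℂ)‖ ^ 2) = rho α := rfl
  have hl' : (lam : ℂ) = (conj (lam : ℂ))⁻¹ := eq_inv_of_mul_eq_one_right hl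
  ext i j
  fin_cases i <;> fin_cases j <;> simp [thetaOfFlip, flip, Theta, hr, -map_inv₀] <;> field_simp <;>
    first
    | linear_combination (conj (α : ℂ)) * hl
    | linear_combination (α : ℂ) * hl
    | exact Or.inl (by rw [mul_comm, hl])

/-- Multiplication by an element of SU(1,1) preserves the class of flip matrices, and `Θ` depends
continuously on its flip matrix because the entry `0 1` does not vanish. -/
theorem eventually_exists_flip_mul (α : 𝔻) (lam : Circle) {c : ℝ} (hc : 0 < c) :
    ∀ᶠ g in 𝓝 (1 : Matrix (Fin 2) (Fin 2) ℂ), ConjSymm g → g.det = 1 →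
      ∃ (α' : 𝔻) (lam' : Circle), flip α' lam' = flip α lam * g ∧
        ∀ i j, ‖Theta α' lam' i j - Theta α lam i j‖ ≤ c := by
  set F := flip α lam with hF
  have hmul : Continuous fun g : Matrix (Fin 2) (Fin 2) ℂ => F * g :=
    continuous_const.matrix_mul continuous_id
  have hcont : ContinuousAt (fun g : Matrix (Fin 2) (Fin 2) ℂ => thetaOfFlip (F * g)) 1 := by
    unfold thetaOfFlip
    have h01 : ContinuousAt (fun g : Matrix (Fin 2) (Fin 2) ℂ => (F * g) 0 1) 1 :=
      (hmul.matrix_elem 0 1).continuousAt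
    refine ContinuousAt.smul (h01.inv₀ ?_) (Continuous.continuousAt ?_)
    · rw [mul_one]; exact flip_zero_one_ne_zero α lam
    · refine continuous_matrix fun i j => ?_
      fin_cases i <;> fin_cases j
      · exact (hmul.matrix_elem 0 0).neg
      · exact continuous_const
      · exact continuous_const
      · exact hmul.matrix_elem 1 1
  have hev : ∀ i j, ∀ᶠ g in 𝓝 (1 : Matrix (Fin 2) (Fin 2) ℂ),
      ‖thetaOfFlip (F * g) i j - Theta α lam i j‖ < c := by
    intro i j
    have h1 : ContinuousAt (fun g : Matrix (Fin 2) (Fin 2) ℂ =>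
        ‖thetaOfFlip (F * g) i j - Theta α lam i j‖) 1 :=
      ((((continuous_apply_apply i j).tendsto _).comp hcont).sub continuousAt_const).norm
    refine h1.eventually_lt_const ?_
    change ‖thetaOfFlip (F * 1) i j - Theta α lam i j‖ < c
    rw [mul_one, ← Theta_eq_thetaOfFlip, sub_self, norm_zero]
    exact hc
  filter_upwards [eventually_all.mpr fun i => eventually_all.mpr (hev i)] with g hg hs hd
  obtain ⟨α', lam', h⟩ := exists_flip_eq ((ConjSymm.flip α lam).mul hs)
    (by rw [Matrix.det_mul, det_flip, hd, mul_one])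
  refine ⟨α', lam', h, fun i j => ?_⟩
  rw [Theta_eq_thetaOfFlip α', h]
  exact (hg i j).le

/-! ### Rotations, boosts and powers of elliptic matrices -/

/-- The diagonal matrix with entries `exp (i s)` and `exp (-i s)`. -/
noncomputable def rotM (s : ℝ) : Matrix (Fin 2) (Fin 2) ℂ :=
  !![Complex.exp (s * Complex.I), 0; 0, Complex.exp (-(s * Complex.I))]

/-- A hyperbolic one-parameter group. -/
noncomputable def boostM (v : ℝ) : Matrix (Fin 2) (Fin 2) ℂ :=
  !![(Real.cosh v : ℂ), (Real.sinh v : ℂ); (Real.sinh v : ℂ), (Real.cosh v : ℂ)]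

theorem ConjSymm.rotM (s : ℝ) : ConjSymm (rotM s) := by
  simp [ConjSymm, PCMV.rotM, ← Complex.exp_conj]

theorem ConjSymm.boostM (v : ℝ) : ConjSymm (boostM v) := by
  simp [ConjSymm, PCMV.boostM, -Complex.ofReal_cosh, -Complex.ofReal_sinh]

theorem det_rotM (s : ℝ) : (rotM s).det = 1 := by
  rw [rotM, Matrix.det_fin_two_of, ← Complex.exp_add]
  simp

theorem det_boostM (v : ℝ) : (boostM v).det = 1 := by
  rw [boostM, Matrix.det_fin_two_of]
  have := Real.cosh_sq_sub_sinh_sq v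
  rw [← pow_two, ← pow_two]
  exact_mod_cast this

theorem tendsto_rotM (σ : ℝ) : Tendsto (fun s => rotM (σ * s)) (𝓝[>] 0) (𝓝 1) := by
  have hc : Continuous fun s => rotM (σ * s) := by
    refine continuous_matrix fun i j => ?_
    fin_cases i <;> fin_cases j <;> simp [rotM] <;> fun_prop
  have h := hc.tendsto 0
  have e : rotM (σ * 0) = 1 := by
    ext i j
    fin_cases i <;> fin_cases j <;> simp [rotM]
  rw [e] at h
  exact h.mono_left nhdsWithin_le_nhds

theorem tendsto_boostM : Tendsto boostM (𝓝[>] 0) (𝓝 1) := by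
  have hc : Continuous boostM := by
    refine continuous_matrix fun i j => ?_
    fin_cases i <;> fin_cases j <;> simp [boostM, -Complex.ofReal_cosh, -Complex.ofReal_sinh] <;>
      exact Complex.continuous_ofReal.comp (by first | exact Real.continuous_cosh | exact Real.continuous_sinh)
  have h := hc.tendsto 0
  have e : boostM 0 = 1 := by
    ext i j
    fin_cases i <;> fin_cases j <;> simp [boostM]
  rw [e] at h
  exact h.mono_left nhdsWithin_le_nhds

/-- The sign `σ` is chosen so that the sine term has the sign opposite to the cosine term; the
latter already has modulus below 1, and the sine term is too small to overshoot. -/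
theorem exists_eventually_elliptic {x : ℂ} (hx : |x.re| ≤ 1) :
    ∃ σ : ℝ, ∀ᶠ s : ℝ in 𝓝[>] 0, |(x * Complex.exp ((σ * s : ℝ) * Complex.I)).re| < 1 := by
  have key : ∀ p r : ℝ, 0 ≤ p → p ≤ 1 → 0 ≤ r →
      ∀ᶠ s : ℝ in 𝓝[>] 0, |p * Real.cos s - r * Real.sin s| < 1 := by
    intro p r hp0 hp1 hr
    have h1 : ∀ᶠ s : ℝ in 𝓝[>] 0, r * Real.sin s < 1 := by
      have : Continuous fun s : ℝ => r * Real.sin s := by fun_prop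
      refine ((this.tendsto 0).mono_left nhdsWithin_le_nhds).eventually_lt_const ?_
      simp
    have h2 : ∀ᶠ s : ℝ in 𝓝[>] 0, s < 1 :=
      (tendsto_id.mono_left nhdsWithin_le_nhds).eventually_lt_const one_pos
    filter_upwards [h1, h2, self_mem_nhdsWithin] with s hs1 hs2 hs0
    have hs0 : 0 < s := hs0
    have hπ := Real.pi_gt_three
    have hc0 : 0 < Real.cos s := Real.cos_pos_of_mem_Ioo ⟨by linarith, by linarith⟩
    have hc1 : Real.cos s < 1 := by
      have := Real.cos_lt_cos_of_nonneg_of_le_pi le_rfl (by linarith : s ≤ Real.pi) hs0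
      rwa [Real.cos_zero] at this
    have hs : 0 < Real.sin s := Real.sin_pos_of_pos_of_lt_pi hs0 (by linarith)
    have h3 : 0 ≤ r * Real.sin s := by positivity
    have h4 : 0 ≤ p * Real.cos s := by positivity
    rw [abs_lt]
    constructor <;> nlinarith
  have hre : ∀ θ : ℝ, (x * Complex.exp (θ * Complex.I)).re
      = x.re * Real.cos θ - x.im * Real.sin θ := by
    intro θ
    rw [Complex.mul_re, Complex.exp_ofReal_mul_I_re, Complex.exp_ofReal_mul_I_im]
  have h1 := abs_le.mp hx
  rcases le_total 0 x.re with hp | hp <;> rcases le_total 0 x.im with hq | hq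
  · refine ⟨1, (key _ _ hp h1.2 hq).mono fun s hs => ?_⟩
    rwa [hre, one_mul]
  · refine ⟨-1, (key _ _ hp h1.2 (neg_nonneg.mpr hq)).mono fun s hs => ?_⟩
    rw [hre, neg_one_mul, Real.cos_neg, Real.sin_neg]
    convert hs using 2
    ring
  · refine ⟨-1, (key _ _ (neg_nonneg.mpr hp) (by linarith) hq).mono fun s hs => ?_⟩
    rw [hre, neg_one_mul, Real.cos_neg, Real.sin_neg, ← abs_neg]
    convert hs using 2
    ring
  · refine ⟨1, (key _ _ (neg_nonneg.mpr hp) (by linarith) (neg_nonneg.mpr hq)).mono fun s hs => ?_⟩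
    rw [hre, one_mul, ← abs_neg]
    convert hs using 2
    ring

/-- Chebyshev form of Cayley-Hamilton. It shows that `B ^ n` depends on `n` only through the point
`exp (i n φ)` of the circle. -/
theorem pow_eq_of_trace_eq_two_cos {B : Matrix (Fin 2) (Fin 2) ℂ} (hdet : B.det = 1) {φ : ℝ}
    (htr : B.trace = ((2 * Real.cos φ : ℝ) : ℂ)) (hφ : Real.sin φ ≠ 0) (n : ℕ) :
    B ^ n = ((Real.sin (n * φ) / Real.sin φ : ℝ) : ℂ) • B
      - ((Real.sin (n * φ - φ) / Real.sin φ : ℝ) : ℂ) • 1 := by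
  induction n with
  | zero =>
    have : Real.sin (((0 : ℕ) : ℝ) * φ - φ) / Real.sin φ = -1 := by
      rw [Nat.cast_zero, zero_mul, zero_sub, Real.sin_neg, neg_div, div_self hφ]
    rw [this]
    simp
  | succ n ih =>
    have hBB := mul_self_eq_trace_smul_sub hdet
    have e1 : ((n + 1 : ℕ) : ℝ) * φ - φ = n * φ := by push_cast; ring
    have e2 : Real.sin (((n + 1 : ℕ) : ℝ) * φ) / Real.sin φ
        = Real.sin (n * φ) / Real.sin φ * (2 * Real.cos φ) - Real.sin (n * φ - φ) / Real.sin φ := by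
      rw [div_mul_eq_mul_div, ← sub_div]
      congr 1
      push_cast
      rw [add_mul, one_mul, Real.sin_add, Real.sin_sub]
      ring
    rw [pow_succ, ih, sub_mul, smul_mul_assoc, smul_mul_assoc, one_mul, hBB, htr, e1, e2]
    rw [smul_sub, smul_smul, ← Complex.ofReal_mul, Complex.ofReal_sub, sub_smul]
    abel

/-- The modulus of the trace of `B ^ n * H` is a continuous function of `exp (i n φ)` whose value at
1 is that of `H`. Powers of an element of the compact circle group return near 1 for arbitrarily
large `n`. -/
theorem exists_trace_pow_mul_gt {B H : Matrix (Fin 2) (Fin 2) ℂ} (hdet : B.det = 1) {r : ℝ}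
    (htr : B.trace = ((2 * r : ℝ) : ℂ)) (hr : |r| < 1) (hH : 2 < ‖H.trace‖) :
    ∃ m : ℕ, 2 < ‖(B ^ (m + 1) * H).trace‖ := by
  have hr' := abs_lt.mp hr
  set φ := Real.arccos r with hφ
  have hcos : Real.cos φ = r := Real.cos_arccos hr'.1.le hr'.2.le
  have hsin : Real.sin φ ≠ 0 := by
    rw [hφ, Real.sin_arccos, Real.sqrt_ne_zero']
    nlinarith
  rw [← hcos] at htr
  set f : Circle → ℝ := fun w => ‖(((w : ℂ).im / Real.sin φ : ℝ) : ℂ) * (B * H).trace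
    - ((((w : ℂ).im * Real.cos φ - (w : ℂ).re * Real.sin φ) / Real.sin φ : ℝ) : ℂ) * H.trace‖ with hf
  have hfc : Continuous f := by
    have h1 : Continuous fun w : Circle => (w : ℂ).im := 
      Complex.continuous_im.comp continuous_subtype_val
    have h2 : Continuous fun w : Circle => (w : ℂ).re := 
      Complex.continuous_re.comp continuous_subtype_val
    refine Continuous.norm (Continuous.sub (Continuous.mul (Complex.continuous_ofReal.comp ?_)
      continuous_const) (Continuous.mul (Complex.continuous_ofReal.comp ?_) continuous_const))
    · exact h1.div_const _
    · exact ((h1.mul continuous_const).sub (h2.mul continuous_const)).div_const _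
  have hf1 : f 1 = ‖H.trace‖ := by
    have h1 : (((1 : Circle) : ℂ).im * Real.cos φ - ((1 : Circle) : ℂ).re * Real.sin φ)
        / Real.sin φ = -1 := by
      rw [Circle.coe_one, Complex.one_im, Complex.one_re, zero_mul, zero_sub, one_mul, neg_div,
        div_self hsin]
    simp only [hf]
    rw [h1, Circle.coe_one, Complex.one_im, zero_div]
    simp
  have hpow : ∀ n : ℕ, f (Circle.exp φ ^ n) = ‖(B ^ n * H).trace‖ := by
    intro n
    have hw : ((Circle.exp φ ^ n : Circle) : ℂ) = Complex.exp ((n * φ : ℝ) * Complex.I) := by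
      rw [Circle.coe_pow, Circle.coe_exp, ← Complex.exp_nat_mul]
      push_cast
      ring_nf
    simp only [hf, hw, Complex.exp_ofReal_mul_I_re, Complex.exp_ofReal_mul_I_im]
    rw [pow_eq_of_trace_eq_two_cos hdet htr hsin, sub_mul, smul_mul_assoc, smul_mul_assoc, one_mul,
      Matrix.trace_sub, Matrix.trace_smul, Matrix.trace_smul, smul_eq_mul, smul_eq_mul, Real.sin_sub]
  have hmem : {w | 2 < f w} ∈ 𝓝 (1 : Circle) :=
    (isOpen_lt continuous_const hfc).mem_nhds (by rw [Set.mem_ofPred_eq, hf1]; exact hH)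
  have hfreq := (mapClusterPt_one_atTop_pow (Circle.exp φ)).frequently hmem
  obtain ⟨n, hn, hn1⟩ := (hfreq.and_eventually (eventually_ge_atTop 1)).exists
  obtain ⟨m, rfl⟩ := Nat.exists_eq_add_of_le' hn1
  refine ⟨m, ?_⟩
  rw [← hpow]
  exact hn

/-- The semigroup generated by a neighbourhood of an element of `SU(1,1)` contains hyperbolic
elements. -/
theorem exists_hyperbolic_word {A : Matrix (Fin 2) (Fin 2) ℂ} (hA : ConjSymm A) (hdet : A.det = 1)
    (htr : ‖A.trace‖ ≤ 2) {p : Matrix (Fin 2) (Fin 2) ℂ → Prop}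
    (hp : ∀ᶠ g in 𝓝 (1 : Matrix (Fin 2) (Fin 2) ℂ), ConjSymm g → g.det = 1 → p g) :
    ∃ g h, p g ∧ p h ∧ ∃ m : ℕ, 2 < ‖((A * g) ^ m * (A * h)).trace‖ := by
  have hre : |(A 0 0).re| ≤ 1 := by
    rw [hA.trace, Complex.norm_real, Real.norm_eq_abs, abs_mul, abs_two] at htr
    linarith
  obtain ⟨σ, hσ⟩ := exists_eventually_elliptic hre
  -- The property is needed on a whole neighbourhood of the rotation `g`, so that `g * boostM v` is
  -- admissible as well.
  have hp' := eventually_eventually_nhds.mpr hp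
  obtain ⟨s, hs1, hs2⟩ := (hσ.and ((tendsto_rotM σ).eventually hp')).exists
  set g := rotM (σ * s) with hg
  have hgs : ConjSymm g := ConjSymm.rotM _
  have hgd : g.det = 1 := det_rotM _
  have htend : Tendsto (fun v => g * boostM v) (𝓝[>] 0) (𝓝 g) := by
    have := (continuous_const.matrix_mul continuous_id :
      Continuous fun B : Matrix (Fin 2) (Fin 2) ℂ => g * B).tendsto 1
    rw [mul_one] at this
    exact this.comp tendsto_boostM
  obtain ⟨v, hv, hv0⟩ := ((htend.eventually hs2).and self_mem_nhdsWithin).exists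
  have hBs := hA.mul hgs
  obtain ⟨m, hm⟩ := exists_trace_pow_mul_gt (B := A * g) (H := boostM v) (r := ((A * g) 0 0).re)
    (by rw [Matrix.det_mul, hdet, hgd, mul_one]) hBs.trace (by
      convert hs1 using 3
      simp [hg, rotM, Matrix.mul_apply, Fin.sum_univ_two]) (by
      rw [(ConjSymm.boostM v).trace, Complex.norm_real]
      have h1 : 1 < Real.cosh v := Real.one_lt_cosh.mpr (ne_of_gt hv0)
      simp only [boostM, Matrix.of_apply, Matrix.cons_val', Matrix.cons_val_zero,
        Matrix.cons_val_fin_one, Complex.ofReal_re]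
      rw [Real.norm_of_nonneg (by linarith)]
      linarith)
  refine ⟨g, g * boostM v, hs2.self_of_nhds hgs hgd, hv (hgs.mul (ConjSymm.boostM v))
    (by rw [Matrix.det_mul, hgd, det_boostM, mul_one]), m, ?_⟩
  rwa [← mul_assoc A g, ← mul_assoc, ← pow_succ]

/-- Arbitrarily close to any periodic pCMV operator and for any `z` on the unit circle there is a
periodic pCMV operator with a spectral gap at `z`. -/
theorem exists_periodic_gap {α : ℤ → 𝔻} {lam : ℤ → Circle} {q : ℕ} (hq : 0 < q)
    (hper : ∀ n : ℤ, α (n + q) = α n ∧ lam (n + q) = lam n) {c : ℝ} (hc : 0 < c) {z : ℂ}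
    (hz : ‖z‖ = 1) :
    ∃ (β : ℤ → 𝔻) (mu : ℤ → Circle) (Q : ℕ), 0 < Q ∧
      (∀ n : ℤ, β (n + Q) = β n ∧ mu (n + Q) = mu n) ∧
      (∀ k i j, ‖Theta (β k) (mu k) i j - Theta (α k) (lam k) i j‖ ≤ c) ∧
      ∃ g : ℝ, 0 < g ∧ ∀ u, g * ‖u‖ ≤ ‖pcmv β mu u - z • u‖ := by
  -- Doubling the period makes it even, so that translation respects the `ℒ`, `ℳ` pairing and the
  -- monodromy matrix has determinant 1.
  wlog hqe : Even q generalizing q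
  · refine this (q := q + q) (by omega) (fun n => ?_) ⟨q, rfl⟩
    push_cast
    rw [← add_assoc, (hper (n + q)).1, (hper (n + q)).2]
    exact hper n
  have hzz : conj z * z = 1 := by rw [Complex.conj_mul', hz]; simp
  set T := transfer z α lam with hT
  set A := cocycle T 1 q with hA
  rcases lt_or_ge 2 ‖A.trace‖ with htr | htr
  · exact ⟨α, lam, q, hq, hper, fun k i j => by simpa using hc.le,
      exists_bounded_below_of_trace hz hq hqe hper htr⟩
  have hAs : ConjSymm A := ConjSymm.cocycle (ConjSymm.transfer z α lam) _ _
  obtain ⟨g, h, ⟨α₁, lam₁, hg1, hg2⟩, ⟨α₂, lam₂, hh1, hh2⟩, m, hm⟩ := exists_hyperbolic_word hAs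
    (det_cocycle (det_transfer hzz α lam) 1 hqe) htr (eventually_exists_flip_mul (α 1) (lam 1) hc)
  set Q := (m + 1) * q with hQ
  have hqQ : (q : ℤ) ∣ Q := ⟨m + 1, by rw [hQ]; push_cast; ring⟩
  -- Only the sites congruent to 1 modulo `q` change: the first in each long period `Q` carries `h`,
  -- the others `g`. Site 1 is odd and comes first in its period, so there the transfer matrix is
  -- `flip` itself and is the rightmost factor of `A`.
  set β : ℤ → 𝔻 := fun n => if (Q : ℤ) ∣ n - 1 then α₂ else if (q : ℤ) ∣ n - 1 then α₁ else α n
    with hβ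
  set mu : ℤ → Circle := fun n =>
    if (Q : ℤ) ∣ n - 1 then lam₂ else if (q : ℤ) ∣ n - 1 then lam₁ else lam n with hmu
  have hαp : Function.Periodic α (q : ℤ) := fun n => (hper n).1
  have hlamp : Function.Periodic lam (q : ℤ) := fun n => (hper n).2
  have hα1 : ∀ n : ℤ, (q : ℤ) ∣ n - 1 → α n = α 1 ∧ lam n = lam 1 := by
    rintro n ⟨d, hd⟩
    have e : n = 1 + d * q := by linear_combination hd
    have h1 := hαp.int_mul d 1
    have h2 := hlamp.int_mul d 1
    rw [Int.cast_id] at h1 h2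
    rw [e]
    exact ⟨h1, h2⟩
  have hQ0 : 0 < Q := by positivity
  have hQe : Even Q := hqe.mul_left _
  have hQper : ∀ n : ℤ, β (n + Q) = β n ∧ mu (n + Q) = mu n := by
    intro n
    have e : n + Q - 1 = n - 1 + Q := by ring
    have h1 : (Q : ℤ) ∣ n + Q - 1 ↔ (Q : ℤ) ∣ n - 1 := by rw [e, dvd_add_self_right]
    have h2 : (q : ℤ) ∣ n + Q - 1 ↔ (q : ℤ) ∣ n - 1 := by rw [e, dvd_add_left hqQ]
    have h3 := hαp.nat_mul (m + 1) n
    have h4 := hlamp.nat_mul (m + 1) n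
    have e2 : ((m + 1 : ℕ) : ℤ) * q = Q := by rw [hQ]; push_cast; ring
    rw [e2] at h3 h4
    simp only [hβ, hmu, h1, h2, h3, h4, and_self]
  refine ⟨β, mu, Q, hQ0, hQper, fun k i j => ?_, exists_bounded_below_of_trace hz hQ0 hQe hQper ?_⟩
  · simp only [hβ, hmu]
    split_ifs with h1 h2
    · rw [(hα1 k (hqQ.trans h1)).1, (hα1 k (hqQ.trans h1)).2]
      exact hh2 i j
    · rw [(hα1 k h2).1, (hα1 k h2).2]
      exact hg2 i j
    · simpa using hc.le
  · set T' := transfer z β mu with hT'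
    have hodd : ∀ j : ℕ, Odd (1 + (j * q : ℕ) : ℤ) := by
      intro j
      have : Even ((j * q : ℕ) : ℤ) := by exact_mod_cast hqe.mul_left j
      exact odd_one.add_even this
    have hT1 : T 1 = flip (α 1) (lam 1) := by rw [hT, transfer, if_pos odd_one]
    obtain ⟨q', rfl⟩ : ∃ q', q = q' + 1 := ⟨q - 1, by omega⟩
    have hβα : ∀ n : ℤ, ¬ ((q' + 1 : ℕ) : ℤ) ∣ n - 1 → T' n = T n := by
      intro n hn
      have hn' : ¬ (Q : ℤ) ∣ n - 1 := fun h => hn (hqQ.trans h)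
      have h1 : β n = α n := by simp only [hβ, if_neg hn, if_neg hn']
      have h2 : mu n = lam n := by simp only [hmu, if_neg hn, if_neg hn']
      simp only [hT, hT', transfer, h1, h2]
    have hTp : Function.Periodic T ((q' + 1 : ℕ) : ℤ) := transfer_periodic hqe hper
    have hblock : ∀ (j : ℕ) (G : Matrix (Fin 2) (Fin 2) ℂ), T' (1 + (j * (q' + 1) : ℕ)) = T 1 * G →
        cocycle T' (1 + (j * (q' + 1) : ℕ)) (q' + 1) = A * G := by
      intro j G hG
      rw [cocycle_succ', hG, hA, cocycle_succ', mul_assoc]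
      congr 1
      refine cocycle_congr fun i hi => ?_
      rw [hβα]
      · have h1 := hTp.nat_mul j (1 + 1 + i)
        rw [← h1]
        congr 1
        push_cast
        ring
      · have e : (1 + ((j * (q' + 1) : ℕ) : ℤ) + 1 + i - 1) = (1 + i : ℤ) + j * ((q' + 1 : ℕ) : ℤ) := by
          push_cast; ring
        rw [e, dvd_add_left (Dvd.intro_left _ rfl)]
        intro hdvd
        have := Int.le_of_dvd (by omega) hdvd
        omega
    have hword : ∀ k ≤ m, cocycle T' 1 ((k + 1) * (q' + 1)) = (A * g) ^ k * (A * h) := by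
      intro k
      induction k with
      | zero =>
        intro _
        have h1 := hblock 0 h (by
          rw [hT1, ← hh1, hT', transfer, if_pos (hodd 0)]
          simp [hβ, hmu])
        simpa using h1
      | succ k ih =>
        intro hk
        have hdq : ((q' + 1 : ℕ) : ℤ) ∣ 1 + (((k + 1) * (q' + 1) : ℕ) : ℤ) - 1 := by
          rw [add_sub_cancel_left]
          exact_mod_cast Dvd.intro_left (k + 1) rfl
        have hdQ : ¬ (Q : ℤ) ∣ 1 + (((k + 1) * (q' + 1) : ℕ) : ℤ) - 1 := by
          rw [add_sub_cancel_left]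
          intro hd
          have h1 := Nat.le_of_dvd (by positivity) (Int.natCast_dvd_natCast.mp hd)
          rw [hQ] at h1
          have h2 := Nat.le_of_mul_le_mul_right h1 (by omega)
          omega
        have h1 := hblock (k + 1) g (by
          rw [hT1, ← hg1, hT', transfer, if_pos (hodd (k + 1))]
          simp only [hβ, hmu, if_pos hdq, if_neg hdQ])
        rw [add_mul (k + 1) 1, one_mul, cocycle_add, h1, ih (by omega), pow_succ', mul_assoc (A * g)]
    rw [hQ, hword m le_rfl]
    exact hm

/-! ### Concatenation of operators with complementary gaps -/

/-- A lower bound `g w` at `w` persists as `g w / 2` on the ball of radius `g w / 2`, and finitely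
many such balls cover the circle. The product of the periods is a common period. -/
theorem exists_finite_gap_cover {α : ℤ → 𝔻} {lam : ℤ → Circle} {q : ℕ} (hq : 0 < q)
    (hper : ∀ n : ℤ, α (n + q) = α n ∧ lam (n + q) = lam n) {c : ℝ} (hc : 0 < c) :
    ∃ (m Q : ℕ) (g : ℝ) (β : ℕ → ℤ → 𝔻) (mu : ℕ → ℤ → Circle), 0 < m ∧ 0 < Q ∧ 0 < g ∧
      (∀ j < m, ∀ n d : ℤ, β j (n + d * Q) = β j n ∧ mu j (n + d * Q) = mu j n) ∧
      (∀ j < m, ∀ k i l, ‖Theta (β j k) (mu j k) i l - Theta (α k) (lam k) i l‖ ≤ c) ∧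
      ∀ z : ℂ, ‖z‖ = 1 → ∃ j < m, ∀ u, g * ‖u‖ ≤ ‖pcmv (β j) (mu j) u - z • u‖ := by
  have hgap := fun (z : ℂ) (hz : ‖z‖ = 1) => exists_periodic_gap hq hper hc hz
  choose! β mu Q hQ hQper hclose g hg hgb using hgap
  obtain ⟨t, ht, hcov⟩ := (isCompact_sphere (0 : ℂ) 1).elim_nhds_subcover
    (fun z => Metric.ball z (if ‖z‖ = 1 then g z / 2 else 1)) fun z hz => by
      rw [mem_sphere_zero_iff_norm] at hz
      exact Metric.ball_mem_nhds _ (by rw [if_pos hz]; exact half_pos (hg z hz))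
  simp only [mem_sphere_zero_iff_norm] at ht
  have hcov' : ∀ z : ℂ, ‖z‖ = 1 → ∃ w ∈ t, ‖z - w‖ < g w / 2 := by
    intro z hz
    obtain ⟨w, hw, hzw⟩ := Set.mem_iUnion₂.mp (hcov (mem_sphere_zero_iff_norm.mpr hz))
    rw [if_pos (ht w hw), Metric.mem_ball, dist_eq_norm] at hzw
    exact ⟨w, hw, hzw⟩
  have htne : t.Nonempty := by
    obtain ⟨w, hw, -⟩ := hcov' 1 (by simp)
    exact ⟨w, hw⟩
  have hmem : ∀ j (h : j < t.card), ((t.equivFin.symm ⟨j, h⟩ : t) : ℂ) ∈ t := fun j h => Subtype.prop _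
  set zs : ℕ → ℂ := fun j => if h : j < t.card then (t.equivFin.symm ⟨j, h⟩ : t) else 0 with hzs
  have hzsm : ∀ j < t.card, zs j ∈ t := fun j h => by
    simp only [hzs, dif_pos h]
    exact hmem j h
  have hzs1 : ∀ j < t.card, ‖zs j‖ = 1 := fun j h => ht _ (hzsm j h)
  have hsurj : ∀ w ∈ t, ∃ j < t.card, zs j = w := fun w hw =>
    ⟨t.equivFin ⟨w, hw⟩, Fin.is_lt _, by simp [hzs]⟩
  refine ⟨t.card, ∏ w ∈ t, Q w, t.inf' htne g / 2, fun j => β (zs j), fun j => mu (zs j),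
    htne.card_pos, Finset.prod_pos fun w hw => hQ w (ht w hw), half_pos ?_, ?_, ?_, ?_⟩
  · exact (Finset.lt_inf'_iff htne).mpr fun w hw => hg w (ht w hw)
  · intro j hj n d
    obtain ⟨e, he⟩ : (Q (zs j) : ℤ) ∣ d * (∏ w ∈ t, Q w : ℕ) :=
      (Int.natCast_dvd_natCast.mpr (Finset.dvd_prod_of_mem Q (hzsm j hj))).mul_left d
    have h := hQper (zs j) (hzs1 j hj)
    have h1 := Function.Periodic.int_mul (f := β (zs j)) (c := (Q (zs j) : ℤ)) (fun n => (h n).1) e n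
    have h2 := Function.Periodic.int_mul (f := mu (zs j)) (c := (Q (zs j) : ℤ)) (fun n => (h n).2) e n
    rw [Int.cast_id, mul_comm, ← he] at h1 h2
    exact ⟨h1, h2⟩
  · exact fun j hj => hclose (zs j) (hzs1 j hj)
  · intro z hz
    obtain ⟨w, hw, hzw⟩ := hcov' z hz
    obtain ⟨j, hj, rfl⟩ := hsurj w hw
    refine ⟨j, hj, fun u => ?_⟩
    have h1 := hgb (zs j) (hzs1 j hj) u
    have h2 : t.inf' htne g ≤ g (zs j) := Finset.inf'_le _ hw
    have h3 : pcmv (β (zs j)) (mu (zs j)) u - zs j • u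
        = (pcmv (β (zs j)) (mu (zs j)) u - z • u) + (z - zs j) • u := by
      rw [sub_smul]; abel
    have h4 : ‖pcmv (β (zs j)) (mu (zs j)) u - zs j • u‖
        ≤ ‖pcmv (β (zs j)) (mu (zs j)) u - z • u‖ + ‖z - zs j‖ * ‖u‖ := by
      conv_lhs => rw [h3]
      refine (norm_add_le _ _).trans ?_
      rw [norm_smul]
    have hu := norm_nonneg u
    nlinarith [mul_le_mul_of_nonneg_right hzw.le hu, mul_le_mul_of_nonneg_right h2 hu]

theorem circleLeb_spectrum_concat_le {m Q : ℕ} {g : ℝ} {β : ℕ → ℤ → 𝔻} {mu : ℕ → ℤ → Circle}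
    (hm : 0 < m) (hQ : 0 < Q) (hg0 : 0 < g)
    (hper : ∀ j < m, ∀ n d : ℤ, β j (n + d * Q) = β j n ∧ mu j (n + d * Q) = mu j n)
    (hg : ∀ z : ℂ, ‖z‖ = 1 → ∃ j < m, ∀ u, g * ‖u‖ ≤ ‖pcmv (β j) (mu j) u - z • u‖)
    (K : ℕ) :
    ∃ (ι : ℤ → ℕ) (P : ℕ), 0 < P ∧ (∀ n, ι n < m) ∧
      (∀ n : ℤ, β (ι (n + P)) (n + P) = β (ι n) n ∧ mu (ι (n + P)) (n + P) = mu (ι n) n) ∧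
      circleLeb (spectrum ℂ (pcmv (fun n => β (ι n) n) fun n => mu (ι n) n)) ≤
        ENNReal.ofReal (m * ((m * (16 * (K + 2) * Q) : ℕ)
          * (6 * Real.pi * (3 * √(4 / (4 + g ^ 2)) ^ K)))) := by
  -- The length `N` is a multiple of `Q`, so each `β j` keeps its phase from block to block. It is
  -- even, and half of it exceeds the `K + 1` layers of width 4 around the centre of a block.
  set N : ℕ := 16 * (K + 2) * Q with hN
  have hN0 : 0 < N := by positivity
  have hNz : (0 : ℤ) < N := by exact_mod_cast hN0
  have hmz : (0 : ℤ) < m := by exact_mod_cast hm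
  set ι : ℤ → ℕ := fun n => (n / N % m).toNat with hι
  have hιm : ∀ n, ι n < m := fun n => by
    have h1 := Int.emod_nonneg (n / N) hmz.ne'
    have h2 := Int.emod_lt_of_pos (n / N) hmz
    simp only [hι]
    omega
  have hιP : ∀ n : ℤ, ι (n + (m * N : ℕ)) = ι n := fun n => by
    simp only [hι]
    rw [Nat.cast_mul, Int.add_mul_ediv_right _ _ hNz.ne', Int.add_emod_right]
  have hNQ : ∀ d : ℤ, d * N = (d * (16 * (K + 2))) * Q := fun d => by
    rw [hN]; push_cast; ring
  have hPper : ∀ n : ℤ, β (ι (n + (m * N : ℕ))) (n + (m * N : ℕ)) = β (ι n) n ∧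
      mu (ι (n + (m * N : ℕ))) (n + (m * N : ℕ)) = mu (ι n) n := fun n => by
    rw [hιP, Nat.cast_mul, hNQ]
    exact hper _ (hιm n) _ _
  have hPe : Even (m * N) := by
    refine Even.mul_left ?_ m
    rw [hN, mul_assoc]
    exact (by decide : Even 16).mul_right _
  refine ⟨ι, m * N, by positivity, hιm, hPper, ?_⟩
  set M : ℤ := 8 * (K + 2) * Q with hM
  have hNM : (N : ℤ) = 2 * M := by rw [hN, hM]; push_cast; ring
  have hMe : Even M := by
    rw [hM, mul_assoc]
    exact (by decide : Even (8 : ℤ)).mul_right _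
  have hMK : 8 * ((K : ℤ) + 2) ≤ M := by
    have : (1 : ℤ) ≤ Q := by exact_mod_cast hQ
    rw [hM]
    exact le_mul_of_one_le_right (by positivity) this
  -- The cut sits one past the middle of the `j`-th block, so that it is odd.
  set k : ℕ → ℤ := fun j => j * N + M + 1 with hk
  have hkodd : ∀ j, Odd (k j) := fun j => by
    have h1 : Even ((j : ℤ) * N + M) := by
      rw [hNM]
      exact (((even_two_mul M).mul_left _)).add hMe
    exact h1.add_one
  have hR := fun j => exists_spectrum_cutOp_subset (α := fun n => β (ι n) n)
    (lam := fun n => mu (ι n) n) (P := m * N) (by positivity) hPe hPper (hkodd j)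
  choose R hRc hRs using hR
  have hκ : (0 : ℝ) ≤ 3 * √(4 / (4 + g ^ 2)) ^ K := by positivity
  have hfin := circleLeb_le_of_near (S := spectrum ℂ (pcmv (fun n => β (ι n) n) fun n => mu (ι n) n))
    (Finset.range m) R (fun j _ => hRc j) hκ fun z hzs hz => by
      obtain ⟨j, hj, hjg⟩ := hg z hz
      -- Windows around all cuts of type `j`. The last has radius 4 and contains both sites of each
      -- removed block; the first has radius `4 * (K + 1)` and stays inside the blocks of type `j`.
      set W : ℕ → Set ℤ := fun i =>
        {n | ∃ d : ℤ, |n - (k j + d * (m * N : ℕ))| ≤ 4 * ((K : ℤ) + 1 - i)} with hW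
      obtain ⟨s, hs, hzs⟩ := exists_near_of_mem_spectrum (α := fun n => β (ι n) n)
        (lam := fun n => mu (ι n) n) (W := W) (K := K)
        (S := {n | ∃ d : ℤ, n = k j + d * (m * N : ℕ)}) (β := β j) (mu := mu j)
        (fun i _ n hn l hl => by
          obtain ⟨d, hd⟩ := hn
          refine ⟨d, (abs_sub_le l n _).trans ?_⟩
          push_cast at hd ⊢
          linarith)
        (fun n hn => by
          obtain ⟨d, hd⟩ := hn
          have hd' := abs_le.mp hd
          have e : ι n = j := by
            have h1 : n / N = j + d * m := by
              rw [Int.ediv_eq_iff_of_pos hNz]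
              simp only [hk] at hd'
              push_cast at hd'
              constructor <;> nlinarith
            simp only [hι]
            rw [h1, Int.add_mul_emod_self_right, Int.emod_eq_of_lt (by positivity)
              (by exact_mod_cast hj), Int.toNat_natCast]
          simp only [e, and_self])
        (by
          rintro n ⟨d, rfl⟩
          exact ⟨d, by simp⟩)
        (by
          rintro n ⟨d, rfl⟩
          exact ⟨d, by rw [add_sub_cancel_left]; simp⟩)
        hz hg0.le hjg hzs
      exact ⟨j, Finset.mem_range.mpr hj, s, hRs j hs, hzs⟩
  rw [Finset.card_range] at hfin
  exact hfin

/-- The cover, and with it `m`, `Q` and `g`, is fixed before `K`. The bound is then linear in `K`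
times `r ^ K` with `r < 1`. -/
theorem exists_periodic_thin {α : ℤ → 𝔻} {lam : ℤ → Circle} {q : ℕ} (hq : 0 < q)
    (hper : ∀ n : ℤ, α (n + q) = α n ∧ lam (n + q) = lam n) {c : ℝ} (hc : 0 < c) {δ : ℝ}
    (hδ : 0 < δ) :
    ∃ (β : ℤ → 𝔻) (mu : ℤ → Circle) (P : ℕ), 0 < P ∧
      (∀ n : ℤ, β (n + P) = β n ∧ mu (n + P) = mu n) ∧
      (∀ k i j, ‖Theta (β k) (mu k) i j - Theta (α k) (lam k) i j‖ ≤ c) ∧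
      circleLeb (spectrum ℂ (pcmv β mu)) < ENNReal.ofReal δ := by
  obtain ⟨m, Q, g, β, mu, hm, hQ, hg0, hQper, hclose, hg⟩ := exists_finite_gap_cover hq hper hc
  set r := √(4 / (4 + g ^ 2)) with hr
  have hr1 : r < 1 := by
    rw [hr, Real.sqrt_lt' one_pos, one_pow, div_lt_one (by positivity)]
    nlinarith [sq_nonneg g, pow_pos hg0 2]
  have hlim : Tendsto (fun K : ℕ => (m : ℝ) * ((m * (16 * (K + 2) * Q) : ℕ)
      * (6 * Real.pi * (3 * r ^ K)))) atTop (𝓝 0) := by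
    have h1 := tendsto_self_mul_const_pow_of_lt_one (r := r) (Real.sqrt_nonneg _) hr1
    have h2 := tendsto_pow_atTop_nhds_zero_of_lt_one (r := r) (Real.sqrt_nonneg _) hr1
    have h3 := (h1.add (h2.const_mul 2)).const_mul (m * (m * (16 * Q) * (6 * Real.pi * 3)) : ℝ)
    rw [mul_zero, add_zero, mul_zero] at h3
    refine h3.congr fun K => ?_
    push_cast
    ring
  obtain ⟨K, hK⟩ := (hlim.eventually_lt_const hδ).exists
  obtain ⟨ι, P, hP, hιm, hPper, hleb⟩ := circleLeb_spectrum_concat_le hm hQ hg0 hQper hg K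
  refine ⟨_, _, P, hP, hPper, fun k => hclose _ (hιm k) k, hleb.trans_lt ?_⟩
  exact (ENNReal.ofReal_lt_ofReal_iff hδ).mpr hK

/-! ### Density -/

theorem pcmv_mem_LP_of_periodic {α : ℤ → 𝔻} {lam : ℤ → Circle} {q : ℕ} (hq : 0 < q)
    (hper : ∀ n : ℤ, α (n + q) = α n ∧ lam (n + q) = lam n) : pcmv α lam ∈ LP := by
  obtain ⟨B, hB1, hB⟩ := exists_le_rho_of_periodic hq fun n => (hper n).1
  have hB0 : 0 < B := by linarith
  have hB2 : (B⁻¹ / 2) ^ 2 < 1 := by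
    have h1 : B⁻¹ ≤ 1 := inv_le_one_of_one_le₀ hB1
    have h2 : 0 < B⁻¹ := by positivity
    nlinarith
  simp only [LP, Set.mem_iUnion]
  -- Halving `B⁻¹` keeps the radius positive even when `B = 1`.
  refine ⟨√(1 - (B⁻¹ / 2) ^ 2), ⟨Real.sqrt_pos.mpr (by linarith), ?_⟩, ⟨α, lam, rfl, fun n => ?_⟩,
    fun _ => pcmv α lam, fun _ => ⟨α, lam, rfl, q, hq, hper⟩, tendsto_const_nhds⟩
  · rw [Real.sqrt_lt' one_pos, one_pow]
    have : 0 < (B⁻¹ / 2) ^ 2 := by positivity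
    linarith
  · have hρ : B⁻¹ ≤ rho (α n) := inv_le_of_inv_le₀ (rho_pos _) (hB n)
    have h1 : rho (α n) ^ 2 = 1 - ‖(α n : ℂ)‖ ^ 2 := by
      have : ‖(α n : ℂ)‖ < 1 := (α n).norm_lt_one
      exact Real.sq_sqrt (by nlinarith [norm_nonneg (α n : ℂ)])
    refine Real.le_sqrt_of_sq_le ?_
    have h2 : 0 < B⁻¹ := by positivity
    nlinarith

theorem dense_thinSpectrum {δ : ℝ} (hδ : 0 < δ) : Dense (thinSpectrum δ) := by
  rw [Metric.dense_iff]
  rintro ⟨E, hE⟩ ε hε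
  obtain ⟨r, -, -, F, hF, hFE⟩ := Set.mem_iUnion₂.mp hE
  obtain ⟨n, hn⟩ := (hFE.eventually (Metric.ball_mem_nhds E (half_pos hε))).exists
  obtain ⟨α, lam, hαF, q, hq, hper⟩ := hF n
  rw [hαF] at hn
  obtain ⟨β, mu, P, hP, hPper, hclose, hleb⟩ :=
    -- The perturbation estimate loses a factor 18, so this choice costs `ε / 4`, on top of the `ε /
    -- 2` already spent.
    exists_periodic_thin hq hper (c := ε / 72) (by positivity) hδ
  refine ⟨⟨pcmv β mu, pcmv_mem_LP_of_periodic hP hPper⟩, ?_, hleb⟩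
  have h1 := norm_pcmv_sub_le β α mu lam (by positivity) hclose
  rw [← dist_eq_norm] at h1
  rw [Metric.mem_ball]
  have h2 : dist (pcmv β mu) E < ε := by
    have := dist_triangle (pcmv β mu) (pcmv α lam) E
    linarith
  exact h2

end PCMV

theorem theorem5p4 (δ : ℝ) (hδ : 0 < δ) :
    Dense (PCMV.thinSpectrum δ) ∧ IsOpen (PCMV.thinSpectrum δ) :=
  ⟨PCMV.dense_thinSpectrum hδ, PCMV.isOpen_thinSpectrum δ⟩
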